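/- All digraphs are finite and have no loops. For a strongly connected digraph $G$ let $\sigma(G)$ be its transmission, i.e. the sum of the distances $|x,y|_G$ (the least number of arrows of a directed path from $x$ to $y$) over all ordered pairs $(x,y)$ of vertices. Let $\overline{G}$ be the symmetric version of $G$, in which $(x,y)$ is an arrow if and only if $(x,y)$ or $(y,x)$ is an arrow of $G$, and let $p(G)=|\sigma(G)-\sigma(\overline{G})|$ be the (gap) price of symmetrisation of the transmission. A tournament is a digraph with exactly one of the arrows $(x,y)$, $(y,x)$ for any two distinct vertices $x,y$. For $3\le k\le n-1$, a tournament $T$ of order $k$ and an arrow $a=(u,v)$ of $T$, the bag $\mathcal H_n(T,k,a)$ is the digraph of order $n$ obtained from $T$ (keeping $a$) by adding a directed path of length $n-k+1$ from $u$ to $v$ whose $n-k$ inner vertices are new. The backward tournament $\mathcal B_k$ has vertices $v_1,\dots,v_k$ and arrows $(v_i,v_{i+1})$ for $1\le i\le k-1$ and $(v_i,v_j)$ for $3\le i\le k$, $1\le j\le i-2$; put $\mathcal H_n(k)=\mathcal H_n(\mathcal B_k,k,(v_k,v_1))$. **Theorem.** Let $n\ge 11$ and $r=n(\sqrt2-1)+8-\frac{11\sqrt2}{2}$.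 1. For every $k$ with $3\le k\le n-1$, every tournament $T$ of order $k$ and every arrow $a$ of $T$ such that $\mathcal H_n(T,k,a)$ is strongly connected, $$p(\mathcal H_n(T,k,a))\le p(\mathcal H_n(k)).$$ 2. $\mathcal H_n(k)$ is strongly connected for every $3\le k\le n-1$, and $3\le\lfloor r\rfloor\le\lceil r\rceil\le n-1$. Let $K^*$ be the (nonempty) set of those $m\in\{\lfloor r\rfloor,\lceil r\rceil\}$ with $p(\mathcal H_n(m))=\max\{p(\mathcal H_n(\lfloor r\rfloor)),p(\mathcal H_n(\lceil r\rceil))\}$. Then for every $k^*\in K^*$ and every $3\le k\le n-1$, $$p(\mathcal H_n(k))\le p(\mathcal H_n(k^*)),$$ with equality if and only if $k\in K^*$. -/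

import Mathlib

/-!
Digraphs are Mathlib's `Digraph V` (a binary relation `Adj`, whose pairs are the arrows).
-/

namespace Digraph

/-- `G.IsWalk x y l`: there is a directed walk with `l` arrows from `x` to `y` in `G`. -/
inductive IsWalk {V : Type*} (G : Digraph V) : V → V → ℕ → Prop
  | nil (x : V) : IsWalk G x x 0
  | cons {x y z : V} {l : ℕ} : G.Adj x y → IsWalk G y z l → IsWalk G x z (l + 1)

/-- There is a directed walk from every vertex to every vertex. -/
def StronglyConnected {V : Type*} (G : Digraph V) : Prop :=
  ∀ x y : V, ∃ l : ℕ, G.IsWalk x y l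

/-- The distance from `x` to `y`: the least length of a directed walk from `x` to `y`.
It is meaningful when `y` can be reached from `x`, in particular in strongly connected digraphs,
the only ones to which it is applied. -/
noncomputable def dist {V : Type*} (G : Digraph V) (x y : V) : ℕ :=
  sInf {l : ℕ | G.IsWalk x y l}

/-- The transmission `σ(G)`: the sum of the distances over all ordered pairs of vertices. -/
noncomputable def transmission {V : Type*} [Fintype V] (G : Digraph V) : ℕ :=
  ∑ x : V, ∑ y : V, G.dist x y

/-- The symmetric version of `G`. -/
def symmetrisation {V : Type*} (G : Digraph V) : Digraph V where
  Adj x y := G.Adj x y ∨ G.Adj y x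

/-- The (gap) price of symmetrisation of the transmission,
`|σ(G) - σ(symmetric version of G)|`. -/
noncomputable def transmissionPrice {V : Type*} [Fintype V] (G : Digraph V) : ℤ :=
  |(G.transmission : ℤ) - (G.symmetrisation.transmission : ℤ)|

/-- A tournament: no loops, and exactly one of the two possible arrows between any two distinct
vertices. -/
def IsTournament {V : Type*} (G : Digraph V) : Prop :=
  (∀ x : V, ¬ G.Adj x x) ∧
    ∀ x y : V, x ≠ y → (G.Adj x y ∧ ¬ G.Adj y x) ∨ (G.Adj y x ∧ ¬ G.Adj x y)

/-- The bag `H_n(T, k, a)` for a digraph `T` of order `k < n` and an arrow `a = (u, v)` of `T`: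
all arrows of `T` (including `a`) are kept, and a new directed path of length `n - k + 1` from `u`
to `v` is added, whose `n - k` inner vertices `inr 0, inr 1, …, inr (n - k - 1)` are new. -/
def bag {V : Type*} (n k : ℕ) (T : Digraph V) (a : V × V) : Digraph (V ⊕ Fin (n - k)) where
  Adj
    | Sum.inl x, Sum.inl y => T.Adj x y
    | Sum.inl x, Sum.inr i => x = a.1 ∧ (i : ℕ) = 0
    | Sum.inr i, Sum.inr j => (j : ℕ) = (i : ℕ) + 1
    | Sum.inr i, Sum.inl y => (i : ℕ) + 1 = n - k ∧ y = a.2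

/-- The backward tournament `B_k` on `v_1, …, v_k`, where `v_{i+1}` is `i : Fin k`: its arrows are
`(v_i, v_{i+1})`, and `(v_i, v_j)` for `j ≤ i - 2`. -/
def backwardTournament (k : ℕ) : Digraph (Fin k) where
  Adj i j := (j : ℕ) = (i : ℕ) + 1 ∨ (j : ℕ) + 2 ≤ (i : ℕ)

/-- The backward bag `H_n(k)`: the bag of order `n` built on `B_k` and its arrow `(v_k, v_1)`.
It is defined for `3 ≤ k < n`; for `k < 3` the value is a placeholder that is never used. -/
def backwardBag (n k : ℕ) : Digraph (Fin k ⊕ Fin (n - k)) :=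
  if h : 3 ≤ k then
    bag n k (backwardTournament k) (⟨k - 1, by omega⟩, ⟨0, by omega⟩)
  else ⊥

/-- The real number `r = n (√2 - 1) + 8 - 11 √2 / 2`. -/
noncomputable def bagThreshold (n : ℕ) : ℝ :=
  n * (Real.sqrt 2 - 1) + 8 - 11 * Real.sqrt 2 / 2

/-- The values of `k*`: those of `⌊r⌋` and `⌈r⌉` whose backward bag has the larger price among the
two (both of them, if the two prices are equal). -/
noncomputable def kStar (n : ℕ) : Set ℕ :=
  {m : ℕ | (m = ⌊bagThreshold n⌋₊ ∨ m = ⌈bagThreshold n⌉₊) ∧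
    (backwardBag n m).transmissionPrice =
      max (backwardBag n ⌊bagThreshold n⌋₊).transmissionPrice
        (backwardBag n ⌈bagThreshold n⌉₊).transmissionPrice}

end Digraph

/-! Put m = n - k and a = (u, v). Because a is kept, the new path never shortens a route between
vertices of T, so all distances in a strong bag are explicit and σ = σ(T) + m (Σ d(x,u) + Σ d(v,y))
+ k m (m+1) + (m (m-1) / 2) (m + 1 + d(v,u)) (`StronglyConnected.two_mul_transmission_bag`). A
symmetrised tournament is complete, so the transmission of the symmetrised bag depends only on n and
k (`IsTournament.transmission_symmetrisation_bag`). Hence, for fixed k, it suffices to maximise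
σ(T), Σ d(x,u), Σ d(v,y) and d(v,u), and the backward bag maximises all of them at once. Distances
from or to a vertex leave no gaps, which bounds the last three by their values along a path; v_1, …,
v_k is a shortest path of B_k, so the arrow (v_k, v_1) attains these bounds. For σ(T)
(`IsTournament.six_mul_transmission_le`), induct on k: some vertex w can be deleted with the rest
still strong, and its distances are bounded using that the vertices at distance at least 2 from w
are exactly its in-neighbours, and dually. For the dependence on k, eight times the increment of the
price from k to k + 1 is (2n-11)² - 2(n+k-7)² plus a correction linear in n and k that depends on
the parity of m. It is positive when k + 1 ≤ r and negative when k ≥ r, so the price increases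
strictly up to ⌊r⌋ and decreases strictly from ⌈r⌉; only these two values compete. -/

namespace Digraph

/-! ### Walks, distances and potentials -/

section Walks

variable {V : Type*} {G : Digraph V} {x y z : V} {k l : ℕ}

theorem IsWalk.append (h : G.IsWalk x y k) (h' : G.IsWalk y z l) : G.IsWalk x z (k + l) := by
  induction h with
  | nil => simpa using h'
  | cons h _ ih => rw [Nat.succ_add]; exact .cons h (ih h')

theorem IsWalk.of_adj (h : G.Adj x y) : G.IsWalk x y 1 := .cons h (.nil y)

theorem IsWalk.eq_of_zero (h : G.IsWalk x y 0) : x = y := by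
  cases h; rfl

theorem IsWalk.exists_last (h : G.IsWalk x z (l + 1)) : ∃ y, G.IsWalk x y l ∧ G.Adj y z := by
  induction l generalizing x with
  | zero =>
    cases h with
    | cons h h' => exact ⟨x, .nil x, h'.eq_of_zero ▸ h⟩
  | succ l ih =>
    cases h with
    | cons h h' =>
      obtain ⟨y, hy, hyz⟩ := ih h'
      exact ⟨y, .cons h hy, hyz⟩

theorem IsWalk.map {W : Type*} {H : Digraph W} (f : V → W) (hf : ∀ a b, G.Adj a b → H.Adj (f a) (f b))
    (h : G.IsWalk x y l) : H.IsWalk (f x) (f y) l := by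
  induction h with
  | nil => exact .nil _
  | cons h _ ih => exact .cons (hf _ _ h) ih

theorem dist_le (h : G.IsWalk x y l) : G.dist x y ≤ l := Nat.sInf_le h

theorem dist_self (x : V) : G.dist x x = 0 := Nat.le_zero.1 (dist_le (.nil x))

theorem StronglyConnected.isWalk_dist (hG : G.StronglyConnected) (x y : V) :
    G.IsWalk x y (G.dist x y) := Nat.sInf_mem (hG x y)

theorem StronglyConnected.dist_eq_zero (hG : G.StronglyConnected) : G.dist x y = 0 ↔ x = y := by
  refine ⟨fun h => ?_, fun h => h ▸ dist_self x⟩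
  have := hG.isWalk_dist x y
  rw [h] at this
  exact this.eq_of_zero

theorem StronglyConnected.dist_triangle (hG : G.StronglyConnected) (x y z : V) :
    G.dist x z ≤ G.dist x y + G.dist y z :=
  dist_le ((hG.isWalk_dist x y).append (hG.isWalk_dist y z))

theorem StronglyConnected.dist_eq_one (hG : G.StronglyConnected) (hxy : x ≠ y) :
    G.dist x y = 1 ↔ G.Adj x y := by
  constructor
  · intro h
    have := hG.isWalk_dist x y
    rw [h] at this
    obtain ⟨z, hz, hzy⟩ := this.exists_last
    rwa [hz.eq_of_zero]
  · intro h
    have h1 := dist_le (IsWalk.of_adj h)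
    have h2 := mt hG.dist_eq_zero.1 hxy
    omega

theorem StronglyConnected.exists_dist_from (hG : G.StronglyConnected) (h : G.dist x y = l + 1) :
    ∃ z, G.dist x z = l ∧ G.Adj z y := by
  have hw := hG.isWalk_dist x y
  rw [h] at hw
  obtain ⟨z, hz, hzy⟩ := hw.exists_last
  have h1 := dist_le hz
  have h2 := hG.dist_triangle x z y
  have h3 := dist_le (IsWalk.of_adj hzy)
  exact ⟨z, by omega, hzy⟩

theorem StronglyConnected.exists_dist_to (hG : G.StronglyConnected) (h : G.dist x y = l + 1) :
    ∃ z, G.dist z y = l ∧ G.Adj x z := by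
  have hw := hG.isWalk_dist x y
  rw [h] at hw
  cases hw with
  | @cons _ z _ _ hxz hz =>
    have h1 := dist_le hz
    have h2 := hG.dist_triangle x z y
    have h3 := dist_le (IsWalk.of_adj hxz)
    exact ⟨z, by omega, hxz⟩

theorem StronglyConnected.exists_dist_from_of_le (hG : G.StronglyConnected) {t : ℕ}
    (h : t ≤ G.dist x y) : ∃ z, G.dist x z = t := by
  obtain ⟨d, hd⟩ := Nat.exists_eq_add_of_le h
  induction d generalizing y with
  | zero => exact ⟨y, by omega⟩
  | succ d ih =>
    obtain ⟨z, hz, -⟩ := hG.exists_dist_from (l := t + d) hd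
    exact ih (by omega) hz

theorem StronglyConnected.exists_dist_to_of_le (hG : G.StronglyConnected) {t : ℕ}
    (h : t ≤ G.dist x y) : ∃ z, G.dist z y = t := by
  obtain ⟨d, hd⟩ := Nat.exists_eq_add_of_le h
  induction d generalizing x with
  | zero => exact ⟨x, by omega⟩
  | succ d ih =>
    obtain ⟨z, hz, -⟩ := hG.exists_dist_to (l := t + d) hd
    exact ih (by omega) hz

/-- A function that behaves like the distance to `y` along arrows is the distance to `y`. -/
theorem isWalk_and_dist_of_potential (f : V → ℕ) (h0 : f y = 0)
    (h1 : ∀ a b, G.Adj a b → f a ≤ f b + 1)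
    (h2 : ∀ a, a ≠ y → ∃ b, G.Adj a b ∧ f b + 1 = f a) (x : V) :
    G.IsWalk x y (f x) ∧ G.dist x y = f x := by
  have lower : ∀ {a b l}, G.IsWalk a b l → f a ≤ f b + l := by
    intro a b l h
    induction h with
    | nil => simp
    | cons h _ ih => have := h1 _ _ h; omega
  have upper : ∀ t a, f a = t → G.IsWalk a y t := by
    intro t
    induction t with
    | zero =>
      intro a ha
      by_cases hay : a = y
      · exact hay ▸ .nil a
      · obtain ⟨b, _, hb⟩ := h2 a hay
        omega
    | succ t ih =>
      intro a ha
      obtain ⟨b, hab, hb⟩ := h2 a (by rintro rfl; omega)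
      exact .cons hab (ih b (by omega))
  have hw := upper _ x rfl
  refine ⟨hw, le_antisymm (dist_le hw) ?_⟩
  have := lower (Nat.sInf_mem (s := {l | G.IsWalk x y l}) ⟨_, hw⟩)
  rw [h0] at this
  simpa [dist] using this

theorem StronglyConnected.symmetrisation (hG : G.StronglyConnected) :
    G.symmetrisation.StronglyConnected := fun x y =>
  (hG x y).imp fun _ h => h.map id fun _ _ => Or.inl

theorem StronglyConnected.transmissionPrice_eq [Fintype V] (hG : G.StronglyConnected) :
    G.transmissionPrice = (G.transmission : ℤ) - (G.symmetrisation.transmission : ℤ) := by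
  refine abs_of_nonneg (sub_nonneg.2 (Nat.cast_le.2 ?_))
  refine Finset.sum_le_sum fun x _ => Finset.sum_le_sum fun y _ => ?_
  exact dist_le ((hG.isWalk_dist x y).map id fun _ _ => Or.inl)

end Walks

/-! ### Sums of integer functions whose values have no gaps -/

section Gapless

variable {V : Type*}

theorem le_card_of_gapless {U : Finset V} {e : V → ℕ} {y : V}
    (h : ∀ t, 1 ≤ t → t ≤ e y → ∃ z ∈ U, e z = t) : e y ≤ U.card := by
  classical
  have : Finset.Icc 1 (e y) ⊆ U.image e := fun t ht => by
    rw [Finset.mem_Icc] at ht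
    obtain ⟨z, hz, rfl⟩ := h t ht.1 ht.2
    exact Finset.mem_image_of_mem e hz
  simpa using (Finset.card_le_card this).trans Finset.card_image_le

/-- Positive values without gaps on a set of `u` elements have sum at most `1 + 2 + ⋯ + u`. -/
theorem two_mul_sum_le_of_gapless (U : Finset V) (e : V → ℕ)
    (h : ∀ y ∈ U, ∀ t, 1 ≤ t → t ≤ e y → ∃ z ∈ U, e z = t) :
    2 * ∑ y ∈ U, e y ≤ U.card * (U.card + 1) := by
  classical
  induction hu : U.card generalizing U with
  | zero => simp [Finset.card_eq_zero.1 hu]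
  | succ u ih =>
    obtain ⟨y, hy, hmax⟩ := U.exists_max_image e (Finset.card_pos.1 (by omega))
    have hle := le_card_of_gapless (h y hy)
    have hc : (U.erase y).card = u := by rw [Finset.card_erase_of_mem hy, hu]; rfl
    have := ih (U.erase y) (fun z hz t ht htz => by
      have hzU := Finset.mem_of_mem_erase hz
      obtain ⟨w, hw, hwt⟩ := h z hzU t ht htz
      -- Erasing the maximum creates no gap: if it was the witness for t, then z, whose value is at
      -- least t, has value exactly t.
      by_cases hwy : w = y
      · exact ⟨z, hz, by subst hwy; have := hmax z hzU; omega⟩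
      · exact ⟨w, Finset.mem_erase.2 ⟨hwy, hw⟩, hwt⟩) hc
    rw [← Finset.add_sum_erase U e hy]
    rw [hu] at hle
    nlinarith

/-- The sum of the values of a gapless rank function with a single zero, in terms of the number of
elements of rank at least two. -/
theorem two_mul_sum_le_of_rank [Fintype V] (d : V → ℕ) (w : V) (hw : ∀ y, d y = 0 ↔ y = w)
    (h : ∀ y t, t ≤ d y → ∃ z, d z = t) (a : ℕ)
    (ha : (Finset.univ.filter fun y => 2 ≤ d y).card = a) :
    2 * ∑ y, d y ≤ 2 * (Fintype.card V - 1) + a * (a + 1) := by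
  classical
  -- Subtracting 1 from the ranks at least 2 gives positive values without gaps; every element other
  -- than w contributes the subtracted 1 again.
  have h1 := two_mul_sum_le_of_gapless (Finset.univ.filter fun y => 2 ≤ d y) (fun y => d y - 1)
    (fun y _ t ht hty => by
      obtain ⟨z, hz⟩ := h y (t + 1) (by omega)
      exact ⟨z, by simp only [Finset.mem_filter, Finset.mem_univ, true_and]; omega, by omega⟩)
  rw [ha] at h1
  have h2 : ∑ y, d y = ∑ y, (if y ≠ w then 1 else 0) +
      ∑ y ∈ Finset.univ.filter (fun y => 2 ≤ d y), (d y - 1) := by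
    rw [Finset.sum_filter, ← Finset.sum_add_distrib]
    refine Finset.sum_congr rfl fun y _ => ?_
    have := hw y
    split_ifs <;> grind
  have h3 : ∑ y, (if y ≠ w then 1 else 0) = Fintype.card V - 1 := by
    rw [← Finset.card_filter, Finset.filter_ne', Finset.card_erase_of_mem (Finset.mem_univ w),
      Finset.card_univ]
  omega

theorem two_mul_sum_le_of_rank_univ [Fintype V] (d : V → ℕ) (w : V) (hw : d w = 0)
    (h : ∀ y t, t ≤ d y → ∃ z, d z = t) :
    2 * ∑ y, d y ≤ (Fintype.card V - 1) * Fintype.card V := by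
  classical
  have hpos : 0 < Fintype.card V := Fintype.card_pos_iff.2 ⟨w⟩
  have h1 := two_mul_sum_le_of_gapless (Finset.univ.erase w) d (fun y _ t ht hty => by
    obtain ⟨z, hz⟩ := h y t hty
    exact ⟨z, Finset.mem_erase.2 ⟨by rintro rfl; omega, Finset.mem_univ z⟩, hz⟩)
  rw [Finset.card_erase_of_mem (Finset.mem_univ w), Finset.card_univ,
    Nat.sub_add_cancel hpos] at h1
  rwa [← Finset.add_sum_erase _ d (Finset.mem_univ w), hw, zero_add]

end Gapless

/-! ### Distance bounds in terms of the order -/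

section Bounds

variable {V : Type*} [Fintype V] {G : Digraph V}

theorem StronglyConnected.two_mul_sum_dist_from_le (hG : G.StronglyConnected) (x : V) :
    2 * ∑ y, G.dist x y ≤ (Fintype.card V - 1) * Fintype.card V :=
  two_mul_sum_le_of_rank_univ _ x (dist_self x) fun _ _ => hG.exists_dist_from_of_le

theorem StronglyConnected.two_mul_sum_dist_to_le (hG : G.StronglyConnected) (y : V) :
    2 * ∑ x, G.dist x y ≤ (Fintype.card V - 1) * Fintype.card V :=
  two_mul_sum_le_of_rank_univ _ y (dist_self y) fun _ _ => hG.exists_dist_to_of_le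

theorem StronglyConnected.dist_le_card_sub_one (hG : G.StronglyConnected) (x y : V) :
    G.dist x y ≤ Fintype.card V - 1 := by
  classical
  have := le_card_of_gapless (U := Finset.univ.erase x) (e := G.dist x) (y := y) (fun t ht hty => by
    obtain ⟨z, hz⟩ := hG.exists_dist_from_of_le hty
    exact ⟨z, Finset.mem_erase.2 ⟨by rintro rfl; rw [dist_self] at hz; omega, Finset.mem_univ z⟩, hz⟩)
  rwa [Finset.card_erase_of_mem (Finset.mem_univ x), Finset.card_univ] at this

end Bounds

/-- The digraph obtained by deleting a vertex. -/
def deleteVertex {V : Type*} (G : Digraph V) (w : V) : Digraph {x : V // x ≠ w} where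
  Adj x y := G.Adj x y

/-- Any two vertices of `S` are joined by a walk inside `S`. -/
def StrongOn {V : Type*} (G : Digraph V) (S : Finset V) : Prop :=
  ∀ x ∈ S, ∀ y ∈ S, Relation.ReflTransGen (fun a b => G.Adj a b ∧ a ∈ S ∧ b ∈ S) x y

/-! ### Strong vertex subsets and their extensions -/

section StrongOn

variable {V : Type*} {G : Digraph V}

theorem IsWalk.exists_adj_leaving {x y : V} {l : ℕ} (h : G.IsWalk x y l) (P : V → Prop)
    (hx : P x) (hy : ¬ P y) : ∃ a b, G.Adj a b ∧ P a ∧ ¬ P b := by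
  induction h with
  | nil => exact absurd hx hy
  | @cons x z _ _ hxz _ ih =>
    by_cases hz : P z
    · exact ih hz hy
    · exact ⟨x, z, hxz, hx, hz⟩

theorem strongOn_singleton (x : V) : G.StrongOn {x} := by
  intro a ha b hb
  rw [Finset.mem_singleton] at ha hb
  subst ha hb
  exact .refl

variable [DecidableEq V]

theorem StrongOn.insert {S : Finset V} (hS : G.StrongOn S) {z a b : V} (ha : a ∈ S) (hb : b ∈ S)
    (hza : G.Adj z a) (hbz : G.Adj b z) : G.StrongOn (insert z S) := by
  have mono : ∀ x ∈ S, ∀ y ∈ S, Relation.ReflTransGen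
      (fun c d => G.Adj c d ∧ c ∈ Insert.insert z S ∧ d ∈ Insert.insert z S) x y :=
    fun x hx y hy => Relation.ReflTransGen.mono (fun _ _ h =>
      ⟨h.1, Finset.mem_insert_of_mem h.2.1, Finset.mem_insert_of_mem h.2.2⟩) _ _ (hS x hx y hy)
  have hz := Finset.mem_insert_self z S
  intro x hx y hy
  rcases Finset.mem_insert.1 hx with rfl | hxS <;> rcases Finset.mem_insert.1 hy with rfl | hyS
  · exact .refl
  · exact .head ⟨hza, hz, Finset.mem_insert_of_mem ha⟩ (mono _ ha _ hyS)
  · exact (mono _ hxS _ hb).tail ⟨hbz, Finset.mem_insert_of_mem hb, hz⟩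
  · exact mono _ hxS _ hyS

/-- The 3-cycles s → p → q → s, one for each s in S, make the set strong even if S itself is not;
this is what allows an element of S to be deleted later. -/
theorem strongOn_insert_insert {S : Finset V} (hS : S.Nonempty) {p q : V}
    (hp : ∀ s ∈ S, G.Adj s p) (hpq : G.Adj p q) (hq : ∀ s ∈ S, G.Adj q s) :
    G.StrongOn (insert p (insert q S)) := by
  obtain ⟨s, hs⟩ := hS
  have mS : ∀ {x}, x ∈ S → x ∈ insert p (insert q S) := fun h => by simp [h]
  have mp : p ∈ insert p (insert q S) := by simp
  have mq : q ∈ insert p (insert q S) := by simp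
  have hqp : Relation.ReflTransGen
      (fun c d => G.Adj c d ∧ c ∈ insert p (insert q S) ∧ d ∈ insert p (insert q S)) q p :=
    .tail (.single ⟨hq s hs, mq, mS hs⟩) ⟨hp s hs, mS hs, mp⟩
  intro x hx y hy
  have hxp : Relation.ReflTransGen
      (fun c d => G.Adj c d ∧ c ∈ insert p (insert q S) ∧ d ∈ insert p (insert q S)) x p := by
    rcases Finset.mem_insert.1 hx with rfl | hx'
    · exact .refl
    rcases Finset.mem_insert.1 hx' with rfl | hx'
    · exact hqp
    · exact .single ⟨hp x hx', hx, mp⟩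
  have hqy : Relation.ReflTransGen
      (fun c d => G.Adj c d ∧ c ∈ insert p (insert q S) ∧ d ∈ insert p (insert q S)) q y := by
    rcases Finset.mem_insert.1 hy with rfl | hy'
    · exact hqp
    rcases Finset.mem_insert.1 hy' with rfl | hy'
    · exact .refl
    · exact .single ⟨hq y hy', mq, hy⟩
  exact (hxp.tail ⟨hpq, mp, mq⟩).trans hqy

variable [Fintype V]

theorem StrongOn.deleteVertex {w : V} (h : G.StrongOn (Finset.univ.erase w)) :
    (G.deleteVertex w).StronglyConnected := by
  rintro ⟨x, hx⟩ ⟨y, hy⟩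
  have := h x (by simpa using hx) y (by simpa using hy)
  induction this with
  | refl => exact ⟨0, .nil _⟩
  | @tail b c _ hbc ih =>
    obtain ⟨l, hl⟩ := ih (by simpa using hbc.2.1)
    exact ⟨l + 1, hl.append (.of_adj (show (G.deleteVertex w).Adj ⟨b, _⟩ ⟨c, _⟩ from hbc.1))⟩

end StrongOn

/-! ### Strong tournaments: vertex deletion and maximal transmission -/

section Tournament

variable {V : Type*} {T : Digraph V}

theorem IsTournament.ne (hT : T.IsTournament) {x y : V} (h : T.Adj x y) : x ≠ y := by
  rintro rfl
  exact hT.1 x h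

theorem IsTournament.not_adj (hT : T.IsTournament) {x y : V} (h : T.Adj x y) : ¬ T.Adj y x := by
  rcases hT.2 x y (hT.ne h) with h' | h'
  · exact h'.2
  · exact absurd h h'.2

theorem IsTournament.adj_of_not (hT : T.IsTournament) {x y : V} (hne : x ≠ y) (h : ¬ T.Adj x y) :
    T.Adj y x := by
  rcases hT.2 x y hne with h' | h'
  · exact absurd h'.1 h
  · exact h'.1

theorem IsTournament.deleteVertex (hT : T.IsTournament) (w : V) :
    (T.deleteVertex w).IsTournament :=
  ⟨fun x => hT.1 x, fun x y hxy => hT.2 x y fun h => hxy (Subtype.ext h)⟩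

variable [Fintype V]

/-- A strong tournament of order at least four has a vertex whose deletion leaves it strong. -/
theorem IsTournament.exists_deleteVertex (hT : T.IsTournament) (hs : T.StronglyConnected)
    (hc : 4 ≤ Fintype.card V) : ∃ w, (T.deleteVertex w).StronglyConnected := by
  classical
  obtain ⟨x₀⟩ : Nonempty V := Fintype.card_pos_iff.1 (by omega)
  let F := (Finset.univ : Finset (Finset V)).filter fun S =>
    S.Nonempty ∧ S ≠ Finset.univ ∧ T.StrongOn S
  have memF : ∀ S, S ∈ F ↔ S.Nonempty ∧ S ≠ Finset.univ ∧ T.StrongOn S := fun S => by simp [F]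
  have hF : F.Nonempty := ⟨{x₀}, (memF _).2 ⟨by simp, fun h => by
    have := congrArg Finset.card h
    rw [Finset.card_singleton, Finset.card_univ] at this
    omega, strongOn_singleton x₀⟩⟩
  -- S is a largest proper strong subset, so any strictly larger strong set is everything.
  obtain ⟨S, hSF, hmax⟩ := F.exists_max_image Finset.card hF
  obtain ⟨hne, hproper, hS⟩ := (memF S).1 hSF
  have huniv : ∀ S' : Finset V, S ⊂ S' → T.StrongOn S' → S' = Finset.univ := by
    intro S' hlt hS'
    by_contra h
    have := hmax S' ((memF S').2 ⟨hne.mono hlt.subset, h, hS'⟩)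
    exact absurd (Finset.card_lt_card hlt) (by omega)
  by_cases hmix : ∃ z, z ∉ S ∧ (∃ a ∈ S, T.Adj z a) ∧ ∃ b ∈ S, T.Adj b z
  · obtain ⟨z, hz, ⟨a, ha, hza⟩, b, hb, hbz⟩ := hmix
    have h := huniv _ (Finset.ssubset_insert hz) (hS.insert ha hb hza hbz)
    refine ⟨z, StrongOn.deleteVertex ?_⟩
    rwa [← h, Finset.erase_insert hz]
  -- Now each outside vertex either dominates S or is dominated by S.
  · push Not at hmix
    have hA : ∀ z, z ∉ S → (∃ a ∈ S, T.Adj z a) → ∀ s ∈ S, T.Adj z s := fun z hz hza s hs' =>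
      hT.adj_of_not (fun h => hz (h ▸ hs')) (hmix z hz hza s hs')
    have hB : ∀ z, z ∉ S → ¬ (∀ s ∈ S, T.Adj s z) → ∀ s ∈ S, T.Adj z s := fun z hz h => by
      push Not at h
      obtain ⟨s, hs', hsz⟩ := h
      exact hA z hz ⟨s, hs', hT.adj_of_not (fun h => hz (h ▸ hs')) hsz⟩
    obtain ⟨s, hsS⟩ := hne
    obtain ⟨z, hz⟩ : ∃ z, z ∉ S := by
      by_contra h
      push Not at h
      exact hproper (Finset.eq_univ_iff_forall.2 h)
    obtain ⟨l, hl⟩ := hs z s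
    obtain ⟨a, b, hab, haS, hbS⟩ := hl.exists_adj_leaving (· ∉ S) hz (not_not.2 hsS)
    obtain ⟨l, hl⟩ := hs s a
    -- The vertex a sends an arrow into S, so it is not dominated by S. A walk from S to a must
    -- therefore pass from a vertex p dominated by S to a vertex q dominating S.
    obtain ⟨p, q, hpq, hp, hq⟩ := hl.exists_adj_leaving
      (fun c => c ∈ S ∨ ∀ s ∈ S, T.Adj s c) (Or.inl hsS)
      (fun h => h.elim haS fun h => hT.not_adj hab (h b (not_not.1 hbS)))
    push Not at hq
    have hq' := hB q hq.1 (by push Not; exact hq.2)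
    have hpS : p ∉ S := fun h => hT.not_adj hpq (hq' p h)
    have hp' : ∀ s ∈ S, T.Adj s p := hp.resolve_left hpS
    have h := huniv _ ⟨fun x hx => by simp [hx], fun h => hpS (h (by simp))⟩
      (strongOn_insert_insert ⟨s, hsS⟩ hp' hpq hq')
    have hcard : Fintype.card V = S.card + 2 := by
      rw [← Finset.card_univ, ← h, Finset.card_insert_of_notMem, Finset.card_insert_of_notMem hq.1]
      simp [hpS, hT.ne hpq]
    -- Here V = S ∪ {p, q} with at least four vertices, so S keeps an element after s is removed and
    -- the 3-cycles survive.
    refine ⟨s, StrongOn.deleteVertex ?_⟩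
    have hsp : p ≠ s := fun h => hpS (h ▸ hsS)
    have hsq : q ≠ s := fun h => hq.1 (h ▸ hsS)
    rw [← h, Finset.erase_insert_of_ne hsp, Finset.erase_insert_of_ne hsq]
    refine strongOn_insert_insert ?_ (fun x hx => hp' x (Finset.mem_of_mem_erase hx)) hpq
      (fun x hx => hq' x (Finset.mem_of_mem_erase hx))
    rw [← Finset.card_pos, Finset.card_erase_of_mem hsS]
    omega

theorem StronglyConnected.exists_adj_from {G : Digraph V} (hs : G.StronglyConnected)
    (hc : 2 ≤ Fintype.card V) (w : V) : ∃ y, G.Adj w y := by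
  obtain ⟨z, hz⟩ := Fintype.exists_ne_of_one_lt_card (by omega) w
  obtain ⟨l, hl⟩ := hs w z
  obtain ⟨a, b, hab, rfl, -⟩ := hl.exists_adj_leaving (· = w) rfl hz
  exact ⟨b, hab⟩

theorem StronglyConnected.exists_adj_to {G : Digraph V} (hs : G.StronglyConnected)
    (hc : 2 ≤ Fintype.card V) (w : V) : ∃ y, G.Adj y w := by
  obtain ⟨z, hz⟩ := Fintype.exists_ne_of_one_lt_card (by omega) w
  obtain ⟨l, hl⟩ := hs z w
  obtain ⟨a, b, hab, -, hb⟩ := hl.exists_adj_leaving (· ≠ w) hz (by simp)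
  exact ⟨a, (not_not.1 hb) ▸ hab⟩

/-- The distances from and to a vertex of a strong tournament. -/
theorem IsTournament.sum_dist_add_sum_dist_le (hT : T.IsTournament) (hs : T.StronglyConnected)
    (hc : 3 ≤ Fintype.card V) (w : V) :
    2 * (∑ y, T.dist w y + ∑ y, T.dist y w) ≤
      Fintype.card V * (Fintype.card V - 1) + 2 * Fintype.card V := by
  classical
  have h1 := two_mul_sum_le_of_rank (fun y => T.dist w y) w
    (fun y => hs.dist_eq_zero.trans eq_comm) (fun _ _ => hs.exists_dist_from_of_le) _ rfl
  have h2 := two_mul_sum_le_of_rank (fun y => T.dist y w) w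
    (fun y => hs.dist_eq_zero) (fun _ _ => hs.exists_dist_to_of_le) _ rfl
  have e1 : (Finset.univ.filter fun y => 2 ≤ T.dist w y) = Finset.univ.filter fun y => T.Adj y w := by
    ext y
    simp only [Finset.mem_filter, Finset.mem_univ, true_and]
    by_cases hy : w = y
    · subst hy; simp [dist_self, hT.1]
    · have a1 := mt hs.dist_eq_zero.1 hy
      have a2 := hs.dist_eq_one hy
      constructor
      · intro h
        exact hT.adj_of_not hy fun h' => by have := a2.2 h'; omega
      · intro h
        have := mt a2.1 (hT.not_adj h)
        omega
  have e2 : (Finset.univ.filter fun y => 2 ≤ T.dist y w) = Finset.univ.filter fun y => T.Adj w y := by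
    ext y
    simp only [Finset.mem_filter, Finset.mem_univ, true_and]
    by_cases hy : y = w
    · subst hy; simp [dist_self, hT.1]
    · have a1 := mt hs.dist_eq_zero.1 hy
      have a2 := hs.dist_eq_one hy
      constructor
      · intro h
        exact hT.adj_of_not hy fun h' => by have := a2.2 h'; omega
      · intro h
        have := mt a2.1 (hT.not_adj h)
        omega
  rw [e1] at h1
  rw [e2] at h2
  obtain ⟨y₁, hy₁⟩ := hs.exists_adj_to (by omega) w
  obtain ⟨y₂, hy₂⟩ := hs.exists_adj_from (by omega) w
  have p1 : 0 < (Finset.univ.filter fun y => T.Adj y w).card :=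
    Finset.card_pos.2 ⟨y₁, by simpa using hy₁⟩
  have p2 : 0 < (Finset.univ.filter fun y => T.Adj w y).card :=
    Finset.card_pos.2 ⟨y₂, by simpa using hy₂⟩
  have p3 : (Finset.univ.filter fun y => T.Adj y w).card +
      (Finset.univ.filter fun y => T.Adj w y).card = Fintype.card V - 1 := by
    rw [← Finset.card_union_of_disjoint, ← Finset.card_univ,
      ← Finset.card_erase_of_mem (Finset.mem_univ w)]
    · congr 1
      ext y
      simp only [Finset.mem_union, Finset.mem_filter, Finset.mem_univ, true_and, Finset.mem_erase,
        and_true]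
      refine ⟨fun h => h.elim (fun h => hT.ne h) fun h => (hT.ne h).symm, fun h => ?_⟩
      by_cases h' : T.Adj y w
      · exact .inl h'
      · exact .inr (hT.adj_of_not h h')
    · rw [Finset.disjoint_filter]
      exact fun y _ h => hT.not_adj h
  generalize (Finset.univ.filter fun y => T.Adj y w).card = a at *
  generalize (Finset.univ.filter fun y => T.Adj w y).card = b at *
  generalize Fintype.card V = k at *
  obtain ⟨a, rfl⟩ := Nat.exists_eq_add_of_le' p1
  obtain ⟨b, rfl⟩ := Nat.exists_eq_add_of_le' p2
  obtain rfl : k = a + b + 3 := by omega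
  rw [show a + b + 3 - 1 = a + b + 2 by omega] at *
  -- The in- and out-degree are now a + 1 and b + 1. By convexity the bound is largest when one
  -- degree is 1, and the deficit is a multiple of a * b.
  nlinarith [Nat.zero_le (a * b)]

/-- Deleting w can only lengthen the distances between the remaining vertices. -/
theorem transmission_le_deleteVertex [DecidableEq V] (G : Digraph V) (w : V)
    (hs : (G.deleteVertex w).StronglyConnected) :
    G.transmission ≤ (G.deleteVertex w).transmission + (∑ y, G.dist w y + ∑ y, G.dist y w) := by
  have h : ∀ x y : {x : V // x ≠ w}, G.dist x y ≤ (G.deleteVertex w).dist x y := fun x y =>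
    dist_le ((hs.isWalk_dist x y).map Subtype.val fun _ _ h => h)
  have h1 := Fintype.sum_eq_add_sum_subtype_ne (fun y => G.dist y w) w
  have h2 := Fintype.sum_eq_add_sum_subtype_ne (fun x => ∑ y, G.dist x y) w
  have h3 : ∑ x : {x : V // x ≠ w}, ∑ y, G.dist x y = ∑ x : {x : V // x ≠ w}, G.dist x w +
      ∑ x : {x : V // x ≠ w}, ∑ y : {x : V // x ≠ w}, G.dist x y := by
    rw [← Finset.sum_add_distrib]
    exact Finset.sum_congr rfl fun x _ => Fintype.sum_eq_add_sum_subtype_ne (fun y => G.dist x y) w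
  have h4 : ∑ x : {x : V // x ≠ w}, ∑ y : {x : V // x ≠ w}, G.dist x y ≤
      (G.deleteVertex w).transmission :=
    Finset.sum_le_sum fun x _ => Finset.sum_le_sum fun y _ => h x y
  unfold transmission at *
  omega

end Tournament

/-- The transmission of a strong tournament of order `k` is at most that of the backward one. -/
theorem IsTournament.six_mul_transmission_le {V : Type*} [Fintype V] {T : Digraph V}
    (hT : T.IsTournament) (hs : T.StronglyConnected) (k : ℕ) (hc : Fintype.card V = k + 3) :
    6 * T.transmission ≤ (k + 4) * (k + 3) * (k + 2) + 3 * (k + 3) * (k + 2) + 6 * (k + 2) := by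
  classical
  induction k generalizing V with
  | zero =>
    -- For three vertices the distances from each vertex add up to at most 1 + 2.
    have : ∑ x : V, ∑ y, T.dist x y ≤ ∑ _x : V, 3 := Finset.sum_le_sum fun x _ => by
      have := hs.two_mul_sum_dist_from_le x
      rw [hc] at this
      omega
    rw [Finset.sum_const, Finset.card_univ, hc] at this
    unfold transmission
    simp at this
    omega
  | succ k ih =>
    obtain ⟨w, hw⟩ := hT.exists_deleteVertex hs (by omega)
    have h1 := ih (hT.deleteVertex w) hw (by
      rw [Fintype.card_subtype_compl, Fintype.card_subtype_eq]; omega)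
    have h2 := transmission_le_deleteVertex T w hw
    have h3 := hT.sum_dist_add_sum_dist_le hs (by omega) w
    rw [hc, show k + 1 + 3 - 1 = k + 3 by omega] at h3
    nlinarith

/-! ### Distances in a bag and in its symmetrisation -/

section BagDistances

variable {V : Type*} {T : Digraph V} {n k : ℕ} {u v : V}

theorem bag_adj_inl_inl {x y : V} : (bag n k T (u, v)).Adj (.inl x) (.inl y) ↔ T.Adj x y := .rfl

theorem bag_adj_inl_inr {x : V} {i : Fin (n - k)} :
    (bag n k T (u, v)).Adj (.inl x) (.inr i) ↔ x = u ∧ (i : ℕ) = 0 := .rfl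

theorem bag_adj_inr_inl {y : V} {i : Fin (n - k)} :
    (bag n k T (u, v)).Adj (.inr i) (.inl y) ↔ (i : ℕ) + 1 = n - k ∧ y = v := .rfl

theorem bag_adj_inr_inr {i j : Fin (n - k)} :
    (bag n k T (u, v)).Adj (.inr i) (.inr j) ↔ (j : ℕ) = i + 1 := .rfl

/-- Contracting the inner vertices of the new path to u turns a walk of the bag into one of T: the
last arrow of the path becomes the arrow (u, v). -/
theorem StronglyConnected.of_bag (huv : T.Adj u v) (h : (bag n k T (u, v)).StronglyConnected) :
    T.StronglyConnected := by
  have key : ∀ {p q l}, (bag n k T (u, v)).IsWalk p q l →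
      ∃ l', T.IsWalk (Sum.elim id (fun _ => u) p) (Sum.elim id (fun _ => u) q) l' := by
    intro p q l hw
    induction hw with
    | nil => exact ⟨0, .nil _⟩
    | @cons p r q l hpr _ ih =>
      obtain ⟨l', hl'⟩ := ih
      rcases p with x | i <;> rcases r with y | j
      · exact ⟨_, .cons hpr hl'⟩
      · rw [bag_adj_inl_inr] at hpr
        obtain ⟨rfl, -⟩ := hpr
        exact ⟨_, hl'⟩
      · rw [bag_adj_inr_inl] at hpr
        obtain ⟨-, rfl⟩ := hpr
        exact ⟨_, .cons huv hl'⟩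
      · exact ⟨_, hl'⟩
  intro x y
  obtain ⟨l, hl⟩ := h (.inl x) (.inl y)
  exact key hl

theorem exists_bag_adj_next (i : Fin (n - k)) (f : V ⊕ Fin (n - k) → ℕ) (t : ℕ)
    (h1 : (i : ℕ) + 1 = n - k → f (.inl v) = t)
    (h2 : ∀ j : Fin (n - k), (j : ℕ) = i + 1 → f (.inr j) = t) :
    ∃ b, (bag n k T (u, v)).Adj (.inr i) b ∧ f b = t := by
  by_cases hi : (i : ℕ) + 1 = n - k
  · exact ⟨.inl v, bag_adj_inr_inl.2 ⟨hi, rfl⟩, h1 hi⟩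
  · exact ⟨.inr ⟨i + 1, by omega⟩, bag_adj_inr_inr.2 rfl, h2 _ rfl⟩

theorem exists_bag_adj_prev (i : Fin (n - k)) (f : V ⊕ Fin (n - k) → ℕ) (t : ℕ)
    (h1 : (i : ℕ) = 0 → f (.inl u) = t)
    (h2 : ∀ j : Fin (n - k), (j : ℕ) + 1 = i → f (.inr j) = t) :
    ∃ b, (bag n k T (u, v)).Adj b (.inr i) ∧ f b = t := by
  by_cases hi : (i : ℕ) = 0
  · exact ⟨.inl u, bag_adj_inl_inr.2 ⟨rfl, hi⟩, h1 hi⟩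
  · exact ⟨.inr ⟨i - 1, by omega⟩, bag_adj_inr_inr.2 (by simp; omega), h2 _ (by simp; omega)⟩

/-- The only way out of the new path is through v, and the detour along it from u to v is no shorter
than the arrow (u, v). -/
theorem StronglyConnected.bag_dist_inl (hs : T.StronglyConnected) (huv : T.Adj u v) (y : V)
    (p : V ⊕ Fin (n - k)) :
    (bag n k T (u, v)).IsWalk p (.inl y)
      (Sum.elim (fun x => T.dist x y) (fun i : Fin (n - k) => (n - k - i) + T.dist v y) p) ∧
    (bag n k T (u, v)).dist p (.inl y) =
      Sum.elim (fun x => T.dist x y) (fun i : Fin (n - k) => (n - k - i) + T.dist v y) p := by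
  have step : ∀ {a b}, T.Adj a b → T.dist a y ≤ T.dist b y + 1 := fun {a b} h => by
    have h1 := hs.dist_triangle a b y
    have h2 := dist_le (IsWalk.of_adj h)
    omega
  refine isWalk_and_dist_of_potential
    (Sum.elim (fun x => T.dist x y) (fun i : Fin (n - k) => (n - k - i) + T.dist v y))
    ?_ ?_ ?_ p
  · exact dist_self y
  · rintro (a | i) (b | j) h
    · exact step h
    · obtain ⟨rfl, hj⟩ := bag_adj_inl_inr.1 h
      have := step huv
      simp only [Sum.elim_inl, Sum.elim_inr]
      omega
    · obtain ⟨hi, rfl⟩ := bag_adj_inr_inl.1 h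
      simp only [Sum.elim_inl, Sum.elim_inr]
      omega
    · have := bag_adj_inr_inr.1 h
      simp only [Sum.elim_inr]
      omega
  · rintro (a | i) ha
    · have hay : T.dist a y ≠ 0 := fun h => ha (by rw [hs.dist_eq_zero.1 h])
      obtain ⟨b, hb, hab⟩ := hs.exists_dist_to (Nat.succ_pred_eq_of_ne_zero hay).symm
      exact ⟨.inl b, hab, by simp only [Sum.elim_inl]; rw [hb]; exact Nat.succ_pred_eq_of_ne_zero hay⟩
    · obtain ⟨b, hb, hb'⟩ := exists_bag_adj_next (T := T) (u := u) (v := v) i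
        (Sum.elim (fun x => T.dist x y) (fun i : Fin (n - k) => (n - k - i) + T.dist v y))
        (n - k - i - 1 + T.dist v y) (fun h => by simp only [Sum.elim_inl]; omega)
        (fun j h => by simp only [Sum.elim_inr]; omega)
      exact ⟨b, hb, by rw [hb']; simp only [Sum.elim_inr]; omega⟩

/-- The new path is entered only through u, so going backwards along it means leaving at v, crossing
T from v to u and starting again. -/
theorem StronglyConnected.bag_dist_inr (hs : T.StronglyConnected) (j : Fin (n - k))
    (p : V ⊕ Fin (n - k)) :
    (bag n k T (u, v)).IsWalk p (.inr j)
      (Sum.elim (fun x => T.dist x u + (j + 1))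
        (fun i : Fin (n - k) => if i ≤ j then (j : ℕ) - i else (n - k - i) + T.dist v u + (j + 1)) p) ∧
    (bag n k T (u, v)).dist p (.inr j) =
      Sum.elim (fun x => T.dist x u + (j + 1))
        (fun i : Fin (n - k) => if i ≤ j then (j : ℕ) - i else (n - k - i) + T.dist v u + (j + 1)) p := by
  refine isWalk_and_dist_of_potential
    (Sum.elim (fun x => T.dist x u + (j + 1))
      (fun i : Fin (n - k) => if i ≤ j then (j : ℕ) - i else (n - k - i) + T.dist v u + (j + 1)))
    (by simp) ?_ ?_ p
  · rintro (a | i) (b | i') h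
    · have h1 := hs.dist_triangle a b u
      have h2 := dist_le (IsWalk.of_adj (bag_adj_inl_inl.1 h))
      simp only [Sum.elim_inl]
      omega
    · obtain ⟨rfl, hj⟩ := bag_adj_inl_inr.1 h
      simp only [Sum.elim_inl, Sum.elim_inr, dist_self, Fin.le_def]
      split_ifs <;> omega
    · obtain ⟨hi, rfl⟩ := bag_adj_inr_inl.1 h
      simp only [Sum.elim_inl, Sum.elim_inr, Fin.le_def]
      split_ifs <;> omega
    · have := bag_adj_inr_inr.1 h
      simp only [Sum.elim_inr, Fin.le_def]
      split_ifs <;> omega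
  · rintro (a | i) ha
    · by_cases hau : a = u
      · subst hau
        refine ⟨.inr ⟨0, j.pos⟩, bag_adj_inl_inr.2 ⟨rfl, rfl⟩, ?_⟩
        simp only [Sum.elim_inl, Sum.elim_inr, dist_self, Fin.le_def]
        rw [if_pos (Nat.zero_le _)]
        omega
      · have hay := mt hs.dist_eq_zero.1 hau
        obtain ⟨b, hb, hab⟩ := hs.exists_dist_to (Nat.succ_pred_eq_of_ne_zero hay).symm
        refine ⟨.inl b, hab, ?_⟩
        simp only [Sum.elim_inl]
        rw [hb]
        have := Nat.succ_pred_eq_of_ne_zero hay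
        omega
    · have hij : (i : ℕ) ≠ j := fun h => ha (by rw [Fin.ext h])
      by_cases hlt : (i : ℕ) < j
      · refine ⟨.inr ⟨i + 1, by omega⟩, bag_adj_inr_inr.2 rfl, ?_⟩
        simp only [Sum.elim_inr, Fin.le_def]
        rw [if_pos (by omega), if_pos (by omega)]
        omega
      · obtain ⟨b, hb, hb'⟩ := exists_bag_adj_next (T := T) (u := u) (v := v) i
          (Sum.elim (fun x => T.dist x u + (j + 1))
            (fun i : Fin (n - k) => if i ≤ j then (j : ℕ) - i else (n - k - i) + T.dist v u + (j + 1)))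
          (n - k - i - 1 + T.dist v u + (j + 1)) (fun h => by simp only [Sum.elim_inl]; omega)
          (fun j h => by
            simp only [Sum.elim_inr, Fin.le_def]
            rw [if_neg (by omega)]; omega)
        refine ⟨b, hb, ?_⟩
        rw [hb']
        simp only [Sum.elim_inr, Fin.le_def]
        rw [if_neg (by omega)]
        omega

theorem StronglyConnected.stronglyConnected_bag (hs : T.StronglyConnected) (huv : T.Adj u v) :
    (bag n k T (u, v)).StronglyConnected := by
  rintro p (y | j)
  · exact ⟨_, (hs.bag_dist_inl huv y p).1⟩
  · exact ⟨_, (hs.bag_dist_inr j p).1⟩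

/-- Distances in a symmetrised bag, through a function `g` of the position along the cycle formed by
the arrow and the new path. -/
theorem bag_symmetrisation_dist {z : V ⊕ Fin (n - k)} (f : V ⊕ Fin (n - k) → ℕ) (g : ℕ → ℕ)
    (hu : f (.inl u) = g 0) (hv : f (.inl v) = g (n - k + 1)) (hi : ∀ i, f (.inr i) = g (i + 1))
    (hz : f z = 0) (hV : ∀ x y, f (.inl x) ≤ f (.inl y) + 1)
    (hg : ∀ p ≤ n - k, g p ≤ g (p + 1) + 1 ∧ g (p + 1) ≤ g p + 1)
    (hx : ∀ x, .inl x ≠ z → ∃ b, (bag n k T (u, v)).symmetrisation.Adj (.inl x) b ∧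
      f b + 1 = f (.inl x))
    (hi' : ∀ i : Fin (n - k), .inr i ≠ z →
      g i + 1 = g (i + 1) ∨ g (i + 2) + 1 = g (i + 1)) (p : V ⊕ Fin (n - k)) :
    (bag n k T (u, v)).symmetrisation.dist p z = f p := by
  have key : ∀ a b, (Digraph.bag n k T (u, v)).Adj a b → f a ≤ f b + 1 ∧ f b ≤ f a + 1 := by
    rintro (a | i) (b | j) h
    · exact ⟨hV a b, hV b a⟩
    · obtain ⟨rfl, hj⟩ := bag_adj_inl_inr.1 h
      have := hg 0 (by omega)
      rw [hi, hu, hj]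
      exact this
    · obtain ⟨h', rfl⟩ := bag_adj_inr_inl.1 h
      have := hg (n - k) le_rfl
      rw [hi, hv, h']
      exact this
    · have hj := bag_adj_inr_inr.1 h
      have := hg j (by omega)
      rw [hi, hi, ← hj]
      exact this
  refine (isWalk_and_dist_of_potential f hz ?_ ?_ p).2
  · rintro a b (h | h)
    · exact (key a b h).1
    · exact (key b a h).2
  · rintro (x | i) h
    · exact hx x h
    · rcases hi' i h with h | h
      · obtain ⟨b, hb, hb'⟩ := exists_bag_adj_prev (T := T) (u := u) (v := v) i f (g i)
          (fun h => by rw [hu, h]) (fun j h => by rw [hi, h])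
        exact ⟨b, .inr hb, by rw [hb', hi, h]⟩
      · obtain ⟨b, hb, hb'⟩ := exists_bag_adj_next (T := T) (u := u) (v := v) i f (g (i + 2))
          (fun h => by rw [hv]; congr 1; omega) (fun j h => by rw [hi, h])
        exact ⟨b, .inl hb, by rw [hb', hi, h]⟩

variable [DecidableEq V]

/-- The new path and the edge uv form a cycle of length n - k + 2, with u at position 0 and v at
position n - k + 1. Any other vertex of T is adjacent to both u and v, so it is one step beyond the
nearer of the two. -/
theorem IsTournament.bag_symmetrisation_dist_inl (hT : T.IsTournament) (huv : T.Adj u v) (y : V)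
    (p : V ⊕ Fin (n - k)) :
    (bag n k T (u, v)).symmetrisation.dist p (.inl y) =
      Sum.elim (fun x => if x = y then 0 else 1)
        (fun i : Fin (n - k) => if y = u then min ((i : ℕ) + 1) (n - k + 1 - i)
          else if y = v then min ((i : ℕ) + 2) (n - k - i) else min ((i : ℕ) + 1) (n - k - i) + 1) p := by
  have hne := hT.ne huv
  have hne' := hne.symm
  refine bag_symmetrisation_dist (T := T) (u := u) (v := v)
    (Sum.elim (fun x => if x = y then 0 else 1)
        (fun i : Fin (n - k) => if y = u then min ((i : ℕ) + 1) (n - k + 1 - i)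
          else if y = v then min ((i : ℕ) + 2) (n - k - i) else min ((i : ℕ) + 1) (n - k - i) + 1))
    (fun q => if y = u then min q (n - k + 2 - q)
      else if y = v then min (q + 1) (n - k + 1 - q) else min q (n - k + 1 - q) + 1)
    ?_ ?_ ?_ ?_ ?_ ?_ ?_ ?_ p
  · simp only [Sum.elim_inl]; split_ifs <;> first | omega | grind
  · simp only [Sum.elim_inl]; split_ifs <;> first | omega | grind
  · intro i; simp only [Sum.elim_inr]; split_ifs <;> omega
  · simp
  · intro a b; simp only [Sum.elim_inl]; split_ifs <;> omega
  · intro q hq; split_ifs <;> omega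
  · intro x hx
    have hxy : x ≠ y := fun h => hx (by rw [h])
    refine ⟨.inl y, ?_, by simp [hxy]⟩
    by_cases h : T.Adj x y
    · exact .inl h
    · exact .inr (hT.adj_of_not hxy h)
  · intro i _; split_ifs <;> omega

theorem IsTournament.bag_symmetrisation_dist_inr (hT : T.IsTournament) (huv : T.Adj u v)
    (j : Fin (n - k)) (p : V ⊕ Fin (n - k)) :
    (bag n k T (u, v)).symmetrisation.dist p (.inr j) =
      Sum.elim (fun x => if x = u then min ((j : ℕ) + 1) (n - k + 1 - j)
          else if x = v then min ((j : ℕ) + 2) (n - k - j) else min ((j : ℕ) + 1) (n - k - j) + 1)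
        (fun i : Fin (n - k) => min (((i : ℕ) - j) + ((j : ℕ) - i))
          (n - k + 2 - (((i : ℕ) - j) + ((j : ℕ) - i)))) p := by
  have hne := hT.ne huv
  have hne' := hne.symm
  have adj : ∀ {x y}, x ≠ y → (bag n k T (u, v)).symmetrisation.Adj (.inl x) (.inl y) := by
    intro x y hxy
    by_cases h : T.Adj x y
    · exact .inl h
    · exact .inr (hT.adj_of_not hxy h)
  refine bag_symmetrisation_dist (T := T) (u := u) (v := v)
    (Sum.elim (fun x => if x = u then min ((j : ℕ) + 1) (n - k + 1 - j)
          else if x = v then min ((j : ℕ) + 2) (n - k - j) else min ((j : ℕ) + 1) (n - k - j) + 1)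
        (fun i : Fin (n - k) => min (((i : ℕ) - j) + ((j : ℕ) - i))
          (n - k + 2 - (((i : ℕ) - j) + ((j : ℕ) - i)))))
    (fun q => min ((q - (j + 1) : ℕ) + (j + 1 - q : ℕ))
          (n - k + 2 - ((q - (j + 1) : ℕ) + (j + 1 - q : ℕ))))
    ?_ ?_ ?_ ?_ ?_ ?_ ?_ ?_ p
  · simp only [Sum.elim_inl, if_true]; omega
  · simp only [Sum.elim_inl, if_true, if_neg hne']; omega
  · intro i; simp only [Sum.elim_inr]; omega
  · simp
  · intro a b; simp only [Sum.elim_inl]; split_ifs <;> omega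
  · intro q hq; omega
  · intro x _
    by_cases hxu : x = u
    · subst hxu
      by_cases h : (j : ℕ) + 1 ≤ n - k + 1 - j
      · exact ⟨.inr ⟨0, by omega⟩, .inl (bag_adj_inl_inr.2 ⟨rfl, rfl⟩), by
          simp only [Sum.elim_inl, Sum.elim_inr, if_true]; omega⟩
      · exact ⟨.inl v, adj hne, by
          simp only [Sum.elim_inl, if_true, if_neg hne']; omega⟩
    · by_cases hxv : x = v
      · subst hxv
        by_cases h : (j : ℕ) + 2 < n - k - j
        · exact ⟨.inl u, adj hne', by simp only [Sum.elim_inl, if_true, if_neg hne']; omega⟩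
        · exact ⟨.inr ⟨n - k - 1, by omega⟩, .inr (bag_adj_inr_inl.2 ⟨by simp; omega, rfl⟩), by
            simp only [Sum.elim_inl, Sum.elim_inr, if_true, if_neg hne']; omega⟩
      · by_cases h : (j : ℕ) + 1 ≤ n - k - j
        · exact ⟨.inl u, adj hxu, by
            simp only [Sum.elim_inl, if_true, if_neg hxu, if_neg hxv]; omega⟩
        · exact ⟨.inl v, adj hxv, by
            simp only [Sum.elim_inl, if_true, if_neg hxu, if_neg hxv, if_neg hne']; omega⟩
  · intro i hi
    have : (i : ℕ) ≠ j := fun h => hi (by rw [Fin.ext h])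
    omega

end BagDistances

/-! ### Summation formulas -/

section Sums

theorem sum_range_tsub_two (m : ℕ) : 2 * ∑ i ∈ Finset.range m, (m - i) = m * (m + 1) := by
  induction m with
  | zero => simp
  | succ m ih =>
    rw [Finset.sum_range_succ']
    simp only [Nat.add_sub_add_right, Nat.sub_zero]
    rw [mul_add, ih]
    ring

theorem sum_range_succ_two (m : ℕ) : 2 * ∑ i ∈ Finset.range m, (i + 1) = m * (m + 1) := by
  induction m with
  | zero => simp
  | succ m ih =>
    rw [Finset.sum_range_succ, mul_add, ih]
    ring

/-- On a directed cycle of length N the two distances between distinct points add up to N. -/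
theorem sum_sum_range_path (N : ℤ) (p : ℕ) :
    2 * ∑ j ∈ Finset.range p, ∑ i ∈ Finset.range p,
      (if i ≤ j then (j : ℤ) - i else N - (i - j)) = p * (p - 1) * N := by
  induction p with
  | zero => simp
  | succ p ih =>
    rw [Finset.sum_range_succ]
    simp_rw [Finset.sum_range_succ _ p]
    rw [Finset.sum_add_distrib, mul_add, mul_add, ih]
    have h : ∑ j ∈ Finset.range p, (if p ≤ j then (j : ℤ) - p else N - (p - j)) +
        ∑ i ∈ Finset.range p, (if i ≤ p then (p : ℤ) - i else N - (i - p)) = p * N := by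
      rw [← Finset.sum_add_distrib, Finset.sum_congr rfl (g := fun _ => N)]
      · simp
      · intro i hi
        rw [Finset.mem_range] at hi
        rw [if_neg (by omega), if_pos hi.le]
        ring
    rw [if_pos le_rfl]
    push_cast
    linear_combination 2 * h

/-- `1 + 2 + ⋯ + 2 + 1`, with `m` summands. -/
def tentSum (m : ℕ) : ℕ := ∑ i ∈ Finset.range m, min (i + 1) (m - i)

theorem tentSum_add_two (m : ℕ) : tentSum (m + 2) = tentSum m + m + 2 := by
  have h : ∀ i ∈ Finset.range m, min (i + 1 + 1) (m + 2 - (i + 1)) = min (i + 1) (m - i) + 1 := by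
    intro i hi
    rw [Finset.mem_range] at hi
    omega
  rw [tentSum, Finset.sum_range_succ, Finset.sum_range_succ', Finset.sum_congr rfl h,
    Finset.sum_add_distrib, tentSum]
  simp

theorem tentSum_two_mul (j : ℕ) : tentSum (2 * j) = j * (j + 1) := by
  induction j with
  | zero => rfl
  | succ j ih =>
    rw [mul_add, mul_one, tentSum_add_two, ih]
    ring

theorem tentSum_two_mul_add_one (j : ℕ) : tentSum (2 * j + 1) = (j + 1) ^ 2 := by
  induction j with
  | zero => rfl
  | succ j ih =>
    rw [show 2 * (j + 1) + 1 = 2 * j + 1 + 2 by ring, tentSum_add_two, ih]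
    ring

theorem sum_tent_left (m : ℕ) :
    ∑ i ∈ Finset.range m, min (i + 1) (m + 1 - i) + 1 = tentSum (m + 1) := by
  rw [tentSum, Finset.sum_range_succ]
  simp

theorem sum_tent_right (m : ℕ) :
    ∑ i ∈ Finset.range m, min (i + 2) (m - i) + 1 = tentSum (m + 1) := by
  rw [tentSum, Finset.sum_range_succ']
  simp

theorem sum_tent_middle (m : ℕ) :
    ∑ i ∈ Finset.range m, (min (i + 1) (m - i) + 1) = tentSum m + m := by
  rw [Finset.sum_add_distrib, tentSum]
  simp

/-- The left side adds the distances from one vertex of a cycle of length m + 2 to all others, the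
last two terms being those to u and v. Rotation invariance, by induction on j, reduces it to an end
of the path. -/
theorem sum_cycle (m j : ℕ) (hj : j < m) :
    ∑ i ∈ Finset.range m, min ((i - j) + (j - i)) (m + 2 - ((i - j) + (j - i))) +
      min (j + 1) (m + 1 - j) + min (j + 2) (m - j) = tentSum (m + 1) := by
  induction j with
  | zero =>
    obtain ⟨m, rfl⟩ := Nat.exists_eq_add_of_le' hj
    rw [Finset.sum_range_succ', ← sum_tent_left (m + 1), Finset.sum_range_succ]
    have h : ∀ i ∈ Finset.range m, min (i + 1 - 0 + (0 - (i + 1)))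
        (m + 1 + 2 - (i + 1 - 0 + (0 - (i + 1)))) = min (i + 1) (m + 1 + 1 - i) := by
      intro i hi
      rw [Finset.mem_range] at hi
      omega
    rw [zero_add, Finset.sum_congr rfl h]
    omega
  | succ j ih =>
    obtain ⟨m, rfl⟩ : ∃ m', m = m' + 1 := ⟨m - 1, by omega⟩
    have h1 := ih (by omega)
    rw [Finset.sum_range_succ] at h1
    rw [Finset.sum_range_succ']
    have h : ∀ i ∈ Finset.range m, min (i + 1 - (j + 1) + (j + 1 - (i + 1)))
        (m + 1 + 2 - (i + 1 - (j + 1) + (j + 1 - (i + 1)))) =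
        min (i - j + (j - i)) (m + 1 + 2 - (i - j + (j - i))) := by
      intro i _
      simp only [Nat.add_sub_add_right]
    rw [Finset.sum_congr rfl h]
    omega

end Sums

/-! ### Transmission of a bag and of its symmetrisation -/

section BagTransmission

variable {V : Type*} [Fintype V] {T : Digraph V} {n k : ℕ} {u v : V}

theorem transmission_eq_sum_to (G : Digraph V) : G.transmission = ∑ y, ∑ x, G.dist x y :=
  Finset.sum_comm

/-- The last term comes from pairs of new vertices, which lie on a directed cycle of length m + 1 +
d(v,u). The sums to u and from v occur once for each new vertex. -/
theorem StronglyConnected.two_mul_transmission_bag (hs : T.StronglyConnected) (huv : T.Adj u v)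
    {m : ℕ} (hm : n - k = m) :
    2 * ((bag n k T (u, v)).transmission : ℤ) =
      2 * T.transmission + 2 * m * (∑ x, T.dist x u + ∑ y, T.dist v y) +
        2 * Fintype.card V * (m * (m + 1)) + m * (m - 1) * (m + 1 + T.dist v u) := by
  have h1 : ∀ y, ∑ p, (bag n k T (u, v)).dist p (.inl y) =
      ∑ x, T.dist x y + (∑ i ∈ Finset.range m, (m - i) + m * T.dist v y) := by
    intro y
    rw [Fintype.sum_sum_type]
    simp_rw [(hs.bag_dist_inl huv y _).2, Sum.elim_inl, Sum.elim_inr]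
    rw [Fin.sum_univ_eq_sum_range (fun i => n - k - i + T.dist v y), hm, Finset.sum_add_distrib]
    simp
  have h2 : ∀ j : Fin (n - k), ((∑ p, (bag n k T (u, v)).dist p (.inr j) : ℕ) : ℤ) =
      (∑ x, T.dist x u : ℕ) + Fintype.card V * ((j : ℕ) + 1 : ℕ) +
        ∑ i ∈ Finset.range m, (if i ≤ j then ((j : ℕ) : ℤ) - i else
          (m + 1 + T.dist v u : ℤ) - (i - (j : ℕ))) := by
    intro j
    subst hm
    rw [Fintype.sum_sum_type]
    simp_rw [(hs.bag_dist_inr j _).2, Sum.elim_inl, Sum.elim_inr, Fin.le_def]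
    rw [Fin.sum_univ_eq_sum_range (fun i => if i ≤ (j : ℕ) then (j : ℕ) - i else
      n - k - i + T.dist v u + (j + 1)), Finset.sum_add_distrib, Nat.cast_add]
    congr 1
    · simp
    · rw [Nat.cast_sum]
      refine Finset.sum_congr rfl fun i hi => ?_
      rw [Finset.mem_range] at hi
      split_ifs <;> omega
  have h3 := sum_sum_range_path (m + 1 + T.dist v u : ℤ) m
  have h4 := sum_range_tsub_two m
  have h5 := sum_range_succ_two m
  rw [transmission_eq_sum_to, transmission_eq_sum_to T, Fintype.sum_sum_type, Nat.cast_add,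
    Nat.cast_sum (Finset.univ : Finset (Fin (n - k)))]
  simp_rw [h1, h2]
  rw [Fin.sum_univ_eq_sum_range (fun j => ((∑ x, T.dist x u : ℕ) : ℤ) + Fintype.card V * (j + 1 : ℕ) +
        ∑ i ∈ Finset.range m, (if i ≤ j then (j : ℤ) - i else
          (m + 1 + T.dist v u : ℤ) - (i - j))), hm]
  rw [Finset.sum_add_distrib, Finset.sum_add_distrib, Finset.sum_add_distrib,
    Finset.sum_add_distrib, ← Finset.mul_sum, ← Finset.mul_sum, Finset.sum_const, Finset.sum_const,
    Finset.card_univ, Finset.card_range, ← Nat.cast_sum (Finset.range m), mul_add, mul_add, mul_add,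
    h3]
  simp only [smul_eq_mul, nsmul_eq_mul]
  zify at h4 h5
  push_cast at h4 h5 ⊢
  linear_combination (Fintype.card V : ℤ) * h4 + (Fintype.card V : ℤ) * h5

/-- The transmission of the symmetrised bag does not depend on the tournament. -/
theorem IsTournament.transmission_symmetrisation_bag (hT : T.IsTournament) (huv : T.Adj u v)
    {m : ℕ} (hm : n - k = m) :
    ((bag n k T (u, v)).symmetrisation.transmission : ℤ) =
      (m + 2) * tentSum (m + 1) + Fintype.card V * (Fintype.card V - 1) - 2 +
        2 * (Fintype.card V - 2) * (tentSum m + m) := by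
  classical
  have hne := hT.ne huv
  have hne' := hne.symm
  obtain ⟨C, hC⟩ : ∃ C : ℤ, C = tentSum (m + 1) := ⟨_, rfl⟩
  obtain ⟨S, hS⟩ : ∃ S : ℤ, S = tentSum m := ⟨_, rfl⟩
  rw [← hC, ← hS]
  have c1 : ((∑ i ∈ Finset.range m, min (i + 1) (m + 1 - i) : ℕ) : ℤ) = C - 1 := by
    rw [hC, ← sum_tent_left]; simp
  have c2 : ((∑ i ∈ Finset.range m, min (i + 2) (m - i) : ℕ) : ℤ) = C - 1 := by
    rw [hC, ← sum_tent_right]; simp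
  have c3 : ((∑ i ∈ Finset.range m, (min (i + 1) (m - i) + 1) : ℕ) : ℤ) = S + m := by
    rw [hS, sum_tent_middle]; simp
  have hB : ∀ y, ((∑ i ∈ Finset.range m, (if y = u then min (i + 1) (m + 1 - i)
          else if y = v then min (i + 2) (m - i) else min (i + 1) (m - i) + 1) : ℕ) : ℤ) =
      (S + m) + (if y = u then C - 1 - (S + m) else 0) +
        (if y = v then C - 1 - (S + m) else 0) := by
    intro y
    by_cases h1 : y = u
    · subst h1
      simp only [if_true, if_neg hne]
      rw [c1]; ring
    · by_cases h2 : y = v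
      · subst h2
        simp only [if_true, if_neg hne']
        rw [c2]; ring
      · simp only [if_neg h1, if_neg h2]
        rw [c3]; ring
  have hB' : ((∑ y, ∑ i ∈ Finset.range m, (if y = u then min (i + 1) (m + 1 - i)
          else if y = v then min (i + 2) (m - i) else min (i + 1) (m - i) + 1) : ℕ) : ℤ) =
      2 * (C - 1) + (Fintype.card V - 2) * (S + m) := by
    rw [Nat.cast_sum]
    simp_rw [hB]
    rw [Finset.sum_add_distrib, Finset.sum_add_distrib, Finset.sum_ite_eq' Finset.univ u,
      Finset.sum_ite_eq' Finset.univ v]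
    simp
    ring
  have h1 : ∑ y, ∑ p, (bag n k T (u, v)).symmetrisation.dist p (.inl y) =
      Fintype.card V * (Fintype.card V - 1) +
      ∑ y, ∑ i ∈ Finset.range m, (if y = u then min (i + 1) (m + 1 - i)
          else if y = v then min (i + 2) (m - i) else min (i + 1) (m - i) + 1) := by
    have : ∀ y : V, ∑ x : V, (if x = y then 0 else 1) = Fintype.card V - 1 := by
      intro y
      simp_rw [← ite_not (p := _ = y)]
      rw [← Finset.card_filter, Finset.filter_ne', Finset.card_erase_of_mem (Finset.mem_univ y),
        Finset.card_univ]
    simp_rw [Fintype.sum_sum_type, hT.bag_symmetrisation_dist_inl huv, Sum.elim_inl, Sum.elim_inr]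
    rw [Finset.sum_add_distrib]
    simp_rw [this]
    congr 1
    · simp
    · refine Finset.sum_congr rfl fun y _ => ?_
      rw [Fin.sum_univ_eq_sum_range (fun i => if y = u then min (i + 1) (n - k + 1 - i)
          else if y = v then min (i + 2) (n - k - i) else min (i + 1) (n - k - i) + 1), hm]
  have h2 : ∑ j, ∑ p, (bag n k T (u, v)).symmetrisation.dist p (.inr j) =
      ∑ x, ∑ i ∈ Finset.range m, (if x = u then min (i + 1) (m + 1 - i)
          else if x = v then min (i + 2) (m - i) else min (i + 1) (m - i) + 1) +
      ∑ j ∈ Finset.range m, ∑ i ∈ Finset.range m,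
        min ((i - j) + (j - i)) (m + 2 - ((i - j) + (j - i))) := by
    simp_rw [Fintype.sum_sum_type, hT.bag_symmetrisation_dist_inr huv, Sum.elim_inl, Sum.elim_inr]
    rw [Finset.sum_add_distrib, Finset.sum_comm]
    congr 1
    · refine Finset.sum_congr rfl fun y _ => ?_
      rw [Fin.sum_univ_eq_sum_range (fun i => if y = u then min (i + 1) (n - k + 1 - i)
          else if y = v then min (i + 2) (n - k - i) else min (i + 1) (n - k - i) + 1), hm]
    · subst hm
      rw [← Fin.sum_univ_eq_sum_range (fun j => ∑ i ∈ Finset.range (n - k),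
        min ((i - j) + (j - i)) (n - k + 2 - ((i - j) + (j - i))))]
      refine Finset.sum_congr rfl fun j _ => ?_
      rw [Fin.sum_univ_eq_sum_range (fun i =>
        min ((i - (j : ℕ)) + (j - i)) (n - k + 2 - ((i - (j : ℕ)) + (j - i))))]
  have h3 : ((∑ j ∈ Finset.range m, ∑ i ∈ Finset.range m,
        min ((i - j) + (j - i)) (m + 2 - ((i - j) + (j - i))) : ℕ) : ℤ) =
      m * C - 2 * (C - 1) := by
    have := Finset.sum_congr rfl fun j hj => sum_cycle m j (Finset.mem_range.1 hj)
    rw [Finset.sum_add_distrib, Finset.sum_add_distrib, Finset.sum_const, Finset.card_range,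
      smul_eq_mul] at this
    have this' := congrArg (Nat.cast (R := ℤ)) this
    rw [Nat.cast_add, Nat.cast_add, c1, c2, Nat.cast_mul] at this'
    linear_combination this' - (m : ℤ) * hC
  have hpos : 1 ≤ Fintype.card V := Fintype.card_pos_iff.2 ⟨u⟩
  rw [transmission_eq_sum_to, Fintype.sum_sum_type, h1, h2, Nat.cast_add, Nat.cast_add,
    Nat.cast_add, hB', h3, Nat.cast_mul, Nat.cast_sub hpos]
  push_cast
  ring

end BagTransmission

/-! ### Distances in the backward tournament -/

section BackwardTournament

theorem isTournament_backwardTournament (k : ℕ) : (backwardTournament k).IsTournament := by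
  refine ⟨fun x => ?_, fun x y hxy => ?_⟩
  · simp only [backwardTournament]; omega
  · have : (x : ℕ) ≠ y := fun h => hxy (Fin.ext h)
    simp only [backwardTournament]; omega

theorem backwardTournament_dist {k : ℕ} (hk : 3 ≤ k) (x y : Fin k) :
    (backwardTournament k).IsWalk x y
      (if (x : ℕ) ≤ y then (y : ℕ) - x else if (x : ℕ) = y + 1 then 2 else 1) ∧
    (backwardTournament k).dist x y =
      if (x : ℕ) ≤ y then (y : ℕ) - x else if (x : ℕ) = y + 1 then 2 else 1 := by
  refine isWalk_and_dist_of_potential (G := backwardTournament k) (fun x : Fin k =>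
    if (x : ℕ) ≤ y then (y : ℕ) - x else if (x : ℕ) = y + 1 then 2 else 1) ?_ ?_ ?_ x
  · simp
  · intro a b hab
    simp only [backwardTournament] at hab
    split_ifs <;> omega
  · intro a ha
    have ha' : (a : ℕ) ≠ y := fun h => ha (Fin.ext h)
    have hlt := a.isLt
    simp only [backwardTournament]
    by_cases h1 : (a : ℕ) ≤ y
    · refine ⟨⟨a + 1, by omega⟩, .inl rfl, ?_⟩
      dsimp only
      split_ifs <;> omega
    · by_cases h2 : (a : ℕ) = y + 1
      -- One step back takes two arrows: jump back by two and advance, or, when the target is the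
      -- first vertex, advance and jump back by two. The latter needs the third vertex.
      · by_cases h3 : (y : ℕ) = 0
        · refine ⟨⟨2, by omega⟩, .inl (by simp; omega), ?_⟩
          dsimp only
          split_ifs <;> omega
        · refine ⟨⟨a - 2, by omega⟩, .inr (by simp; omega), ?_⟩
          dsimp only
          split_ifs <;> omega
      · refine ⟨y, .inr (by omega), ?_⟩
        rw [if_neg h1, if_neg h2]
        split_ifs <;> omega

theorem stronglyConnected_backwardTournament {k : ℕ} (hk : 3 ≤ k) :
    (backwardTournament k).StronglyConnected := fun x y => ⟨_, (backwardTournament_dist hk x y).1⟩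

theorem six_mul_sum_sum_backward (k : ℕ) :
    6 * ∑ x ∈ Finset.range (k + 1), ∑ y ∈ Finset.range (k + 1),
      (if x ≤ y then y - x else if x = y + 1 then 2 else 1) =
    (k + 2) * (k + 1) * k + 3 * (k + 1) * k + 6 * k := by
  induction k with
  | zero => simp
  | succ k ih =>
    rw [Finset.sum_range_succ]
    simp_rw [Finset.sum_range_succ _ (k + 1)]
    rw [Finset.sum_add_distrib, mul_add, mul_add, ih]
    have h1 : ∑ x ∈ Finset.range (k + 1), (if x ≤ k + 1 then k + 1 - x else
        if x = k + 1 + 1 then 2 else 1) = ∑ x ∈ Finset.range (k + 1), (k + 1 - x) :=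
      Finset.sum_congr rfl fun x hx => if_pos (Finset.mem_range.1 hx).le
    have h2 : ∑ y ∈ Finset.range (k + 1), (if k + 1 ≤ y then y - (k + 1) else
        if k + 1 = y + 1 then 2 else 1) = k + 2 := by
      rw [Finset.sum_range_succ, Finset.sum_congr rfl (g := fun _ => 1)]
      · simp
      · intro y hy
        rw [Finset.mem_range] at hy
        rw [if_neg (by omega), if_neg (by omega)]
    have h3 := sum_range_tsub_two (k + 1)
    rw [h1, h2, if_pos le_rfl]
    simp only [Nat.sub_self, add_zero]
    linear_combination 3 * h3

theorem six_mul_transmission_backwardTournament (k : ℕ) :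
    6 * (backwardTournament (k + 3)).transmission =
      (k + 4) * (k + 3) * (k + 2) + 3 * (k + 3) * (k + 2) + 6 * (k + 2) := by
  rw [← six_mul_sum_sum_backward (k + 2), transmission]
  simp_rw [(backwardTournament_dist (Nat.le_add_left 3 k) _ _).2]
  rw [← Fin.sum_univ_eq_sum_range (fun x => ∑ y ∈ Finset.range (k + 2 + 1),
      (if x ≤ y then y - x else if x = y + 1 then 2 else 1))]
  congr 1
  refine Finset.sum_congr rfl fun x _ => ?_
  rw [Fin.sum_univ_eq_sum_range (fun y => if (x : ℕ) ≤ y then y - x else if (x : ℕ) = y + 1 then 2 else 1)]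

theorem sum_dist_last_backwardTournament (k : ℕ) :
    2 * ∑ x, (backwardTournament (k + 3)).dist x (Fin.last (k + 2)) = (k + 2) * (k + 3) := by
  simp_rw [(backwardTournament_dist (Nat.le_add_left 3 k) _ _).2]
  rw [← sum_range_tsub_two (k + 2),
    Fin.sum_univ_eq_sum_range (fun x => if x ≤ ((Fin.last (k + 2) : Fin (k + 3)) : ℕ) then
      ((Fin.last (k + 2) : Fin (k + 3)) : ℕ) - x else
      if x = ((Fin.last (k + 2) : Fin (k + 3)) : ℕ) + 1 then 2 else 1),
    Finset.sum_range_succ]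
  simp only [Fin.val_last]
  rw [if_pos le_rfl, Nat.sub_self, add_zero]
  congr 1
  exact Finset.sum_congr rfl fun x hx => if_pos (Finset.mem_range.1 hx).le

theorem sum_dist_zero_backwardTournament (k : ℕ) :
    2 * ∑ y, (backwardTournament (k + 3)).dist 0 y = (k + 2) * (k + 3) := by
  simp_rw [(backwardTournament_dist (Nat.le_add_left 3 k) _ _).2]
  rw [← sum_range_succ_two (k + 2)]
  simp only [Fin.val_zero, Nat.zero_le, if_true, Nat.sub_zero]
  rw [Fin.sum_univ_eq_sum_range (fun y => y), Finset.sum_range_succ', add_zero]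

theorem dist_zero_last_backwardTournament (k : ℕ) :
    (backwardTournament (k + 3)).dist 0 (Fin.last (k + 2)) = k + 2 := by
  rw [(backwardTournament_dist (Nat.le_add_left 3 k) _ _).2]
  simp

end BackwardTournament

/-! ### Optimality of the backward bag for fixed k -/

theorem backwardBag_eq (n k : ℕ) : backwardBag n (k + 3) =
    bag n (k + 3) (backwardTournament (k + 3)) (Fin.last (k + 2), 0) := by
  rw [backwardBag, dif_pos (Nat.le_add_left 3 k)]
  rfl

theorem backwardTournament_adj_last_zero (k : ℕ) :
    (backwardTournament (k + 3)).Adj (Fin.last (k + 2)) 0 :=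
  .inr (by simp)

theorem stronglyConnected_backwardBag (n k : ℕ) : (backwardBag n (k + 3)).StronglyConnected := by
  rw [backwardBag_eq]
  exact (stronglyConnected_backwardTournament (Nat.le_add_left 3 k)).stronglyConnected_bag
    (backwardTournament_adj_last_zero k)

theorem IsTournament.transmissionPrice_bag_le {V : Type*} [Fintype V] {T : Digraph V}
    (hT : T.IsTournament) {n k : ℕ} (hc : Fintype.card V = k + 3) {u v : V} (huv : T.Adj u v)
    (hb : (bag n (k + 3) T (u, v)).StronglyConnected) :
    (bag n (k + 3) T (u, v)).transmissionPrice ≤ (backwardBag n (k + 3)).transmissionPrice := by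
  have hs := hb.of_bag huv
  have huv' := backwardTournament_adj_last_zero k
  obtain ⟨m, hm⟩ : ∃ m, n - (k + 3) = m := ⟨_, rfl⟩
  rw [hb.transmissionPrice_eq, (stronglyConnected_backwardBag n k).transmissionPrice_eq,
    backwardBag_eq, hT.transmission_symmetrisation_bag huv hm,
    (isTournament_backwardTournament _).transmission_symmetrisation_bag huv' hm, hc,
    Fintype.card_fin]
  refine sub_le_sub_right ?_ _
  have e1 := hs.two_mul_transmission_bag (n := n) (k := k + 3) huv hm
  have e2 := (stronglyConnected_backwardTournament (Nat.le_add_left 3 k)).two_mul_transmission_bag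
    (n := n) (k := k + 3) huv' hm
  rw [hc] at e1
  rw [Fintype.card_fin, dist_zero_last_backwardTournament] at e2
  have a1 := hT.six_mul_transmission_le hs k hc
  rw [← six_mul_transmission_backwardTournament] at a1
  have a2 := hs.two_mul_sum_dist_to_le u
  have a3 := hs.two_mul_sum_dist_from_le v
  have a4 := hs.dist_le_card_sub_one v u
  rw [hc, show k + 3 - 1 = k + 2 by omega] at a2 a3 a4
  rw [← sum_dist_last_backwardTournament] at a2
  rw [← sum_dist_zero_backwardTournament] at a3
  have b1 : (T.transmission : ℤ) ≤ (backwardTournament (k + 3)).transmission := by omega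
  have b2 : (∑ x, T.dist x u : ℤ) + ∑ y, (T.dist v y : ℤ) ≤
      ∑ x, ((backwardTournament (k + 3)).dist x (Fin.last (k + 2)) : ℤ) +
        ∑ y, ((backwardTournament (k + 3)).dist 0 y : ℤ) := by
    zify at a2 a3
    linarith
  have b3 : (T.dist v u : ℤ) ≤ (k + 2 : ℕ) := by exact_mod_cast a4
  have b4 : 0 ≤ (m : ℤ) * (m - 1) := by
    rcases Nat.eq_zero_or_pos m with rfl | h
    · simp
    · exact mul_nonneg (by positivity) (by omega)
  have c2 := mul_le_mul_of_nonneg_left b2 (Nat.cast_nonneg (α := ℤ) m)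
  have c3 := mul_le_mul_of_nonneg_left b3 b4
  push_cast at e1 e2 c3 ⊢
  linarith

/-! ### Price of the backward bag as a function of k -/

theorem six_mul_transmissionPrice_backwardBag (k m : ℕ) :
    6 * (backwardBag (k + 3 + m) (k + 3)).transmissionPrice =
      ((k + 4) * (k + 3) * (k + 2) + 3 * (k + 3) * (k + 2) + 6 * (k + 2)) +
        6 * m * (k + 3) * (k + 2) + 6 * (k + 3) * (m * (m + 1)) +
        3 * m * (m - 1) * (m + k + 3) -
        6 * ((m + 2) * tentSum (m + 1) + (k + 3) * (k + 2) - 2 + 2 * (k + 1) * (tentSum m + m)) := by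
  have huv := backwardTournament_adj_last_zero k
  have hm : k + 3 + m - (k + 3) = m := by omega
  have e := (stronglyConnected_backwardTournament (Nat.le_add_left 3 k)).two_mul_transmission_bag
    (n := k + 3 + m) (k := k + 3) huv hm
  rw [(stronglyConnected_backwardBag _ k).transmissionPrice_eq, backwardBag_eq,
    (isTournament_backwardTournament _).transmission_symmetrisation_bag huv hm]
  rw [Fintype.card_fin, dist_zero_last_backwardTournament] at e
  rw [Fintype.card_fin]
  have a1 := six_mul_transmission_backwardTournament k
  have a2 := sum_dist_last_backwardTournament k
  have a3 := sum_dist_zero_backwardTournament k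
  zify at a1 a2 a3
  push_cast at e ⊢
  linear_combination 3 * e + a1 + 3 * m * (a2 + a3)

/-- Increment of the price when an even number of new vertices is decreased by one. -/
theorem transmissionPrice_backwardBag_sub_of_even (k j : ℕ) {n : ℕ} (hn : n = k + 3 + (2 * j + 2)) :
    8 * ((backwardBag n (k + 4)).transmissionPrice - (backwardBag n (k + 3)).transmissionPrice) =
      ((2 * n - 11) ^ 2 - 2 * (n + k - 4) ^ 2) + 4 * (n - k - 3) - 15 := by
  have h1 := six_mul_transmissionPrice_backwardBag k (2 * j + 2)
  have h2 := six_mul_transmissionPrice_backwardBag (k + 1) (2 * j + 1)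
  rw [← hn, show 2 * j + 2 = 2 * (j + 1) by ring, tentSum_two_mul_add_one, tentSum_two_mul] at h1
  rw [show k + 1 + 3 + (2 * j + 1) = n by omega, tentSum_two_mul_add_one,
    show 2 * j + 1 + 1 = 2 * (j + 1) by ring, tentSum_two_mul] at h2
  have hn' : (n : ℤ) = k + 3 + (2 * j + 2) := by exact_mod_cast hn
  rw [hn']
  push_cast at h1 h2
  refine mul_left_cancel₀ (show (6 : ℤ) ≠ 0 by norm_num) ?_
  linear_combination 8 * h2 - 8 * h1

/-- Increment of the price when an odd number of new vertices is decreased by one. -/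
theorem transmissionPrice_backwardBag_sub_of_odd (k j : ℕ) {n : ℕ} (hn : n = k + 3 + (2 * j + 1)) :
    8 * ((backwardBag n (k + 4)).transmissionPrice - (backwardBag n (k + 3)).transmissionPrice) =
      ((2 * n - 11) ^ 2 - 2 * (n + k - 4) ^ 2) + 8 * k - 9 := by
  have h1 := six_mul_transmissionPrice_backwardBag k (2 * j + 1)
  have h2 := six_mul_transmissionPrice_backwardBag (k + 1) (2 * j)
  rw [← hn, show 2 * j + 1 + 1 = 2 * (j + 1) by ring, tentSum_two_mul_add_one,
    tentSum_two_mul] at h1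
  rw [show k + 1 + 3 + 2 * j = n by omega, tentSum_two_mul_add_one, tentSum_two_mul] at h2
  have hn' : (n : ℤ) = k + 3 + (2 * j + 1) := by exact_mod_cast hn
  rw [hn']
  push_cast at h1 h2
  refine mul_left_cancel₀ (show (6 : ℤ) ≠ 0 by norm_num) ?_
  linear_combination 8 * h2 - 8 * h1

theorem transmissionPrice_backwardBag_lt_succ {n k : ℕ} (hn : 11 ≤ n) (hk : 3 ≤ k) (hkn : k + 1 < n)
    (h : 2 * (n + k - 7 : ℤ) ^ 2 < (2 * n - 11) ^ 2) :
    (backwardBag n k).transmissionPrice < (backwardBag n (k + 1)).transmissionPrice := by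
  obtain ⟨k, rfl⟩ := Nat.exists_eq_add_of_le' hk
  push_cast at h
  rw [show (n + (k + 3) - 7 : ℤ) = n + k - 4 by ring] at h
  obtain ⟨m, hm⟩ : ∃ m, n = k + 3 + m := ⟨n - (k + 3), by omega⟩
  have hm' : (n : ℤ) = k + 3 + m := by exact_mod_cast hm
  rcases Nat.even_or_odd' m with ⟨j, rfl | rfl⟩
  · obtain ⟨j, rfl⟩ : ∃ j', j = j' + 1 := ⟨j - 1, by omega⟩
    have e := transmissionPrice_backwardBag_sub_of_even k j (n := n) (by omega)
    -- With at least four new vertices the correction 4(n-k-3) - 15 is positive; with two, the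
    -- hypothesis itself fails.
    have hj : 1 ≤ j := by
      rcases Nat.eq_zero_or_pos j with rfl | hj
      · obtain rfl : n = k + 5 := by omega
        push_cast at h
        nlinarith
      · exact hj
    push_cast at hm'
    have : (1 : ℤ) ≤ j := by exact_mod_cast hj
    show (backwardBag n (k + 3)).transmissionPrice < (backwardBag n (k + 4)).transmissionPrice
    linarith
  · have e := transmissionPrice_backwardBag_sub_of_odd k j (n := n) (by omega)
    have hn' : (11 : ℤ) ≤ n := by exact_mod_cast hn
    show (backwardBag n (k + 3)).transmissionPrice < (backwardBag n (k + 4)).transmissionPrice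
    -- The correction 8k - 9 is positive from k = 2 on (k being shifted by 3). The two smaller
    -- values use n ≥ 11; for k = 1 the case n = 11 contradicts the hypothesis.
    rcases Nat.lt_or_ge k 2 with hk2 | hk2
    · interval_cases k
      · push_cast at e
        nlinarith
      · push_cast at e h
        have : (12 : ℤ) ≤ n := by
          by_contra hlt
          obtain rfl : n = 11 := by omega
          norm_num at h
        nlinarith
    · have : (2 : ℤ) ≤ k := by exact_mod_cast hk2
      linarith

theorem transmissionPrice_backwardBag_succ_lt {n k : ℕ} (hk : 3 ≤ k) (hkn : k + 1 < n)
    (h : (2 * n - 11 : ℤ) ^ 2 < 2 * (n + k - 8) ^ 2) :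
    (backwardBag n (k + 1)).transmissionPrice < (backwardBag n k).transmissionPrice := by
  obtain ⟨k, rfl⟩ := Nat.exists_eq_add_of_le' hk
  push_cast at h
  obtain ⟨m, hm⟩ : ∃ m, n = k + 3 + m := ⟨n - (k + 3), by omega⟩
  have hm' : (n : ℤ) = k + 3 + m := by exact_mod_cast hm
  show (backwardBag n (k + 4)).transmissionPrice < (backwardBag n (k + 3)).transmissionPrice
  -- The hypothesis has n + k - 5 in the shifted k, against n + k - 4 in the increment; the gap
  -- between the two squares outweighs the positive part of the correction.
  rcases Nat.even_or_odd' m with ⟨j, rfl | rfl⟩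
  · obtain ⟨j, rfl⟩ : ∃ j', j = j' + 1 := ⟨j - 1, by omega⟩
    have e := transmissionPrice_backwardBag_sub_of_even k j (n := n) (by omega)
    nlinarith
  · have e := transmissionPrice_backwardBag_sub_of_odd k j (n := n) (by omega)
    push_cast at hm'
    nlinarith

/-! ### The threshold r and monotonicity on both sides of it -/

theorem bagThreshold_eq (n : ℕ) : bagThreshold n = Real.sqrt 2 * (n - 11 / 2) + 8 - n := by
  unfold bagThreshold
  ring

theorem lt_of_le_bagThreshold {n k : ℕ} (hn : 11 ≤ n) (hk : 3 ≤ k)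
    (h : ((k + 1 : ℕ) : ℝ) ≤ bagThreshold n) : 2 * (n + k - 7 : ℤ) ^ 2 < (2 * n - 11) ^ 2 := by
  have hn' : (11 : ℝ) ≤ n := by exact_mod_cast hn
  have hk' : (3 : ℝ) ≤ k := by exact_mod_cast hk
  rw [bagThreshold_eq] at h
  push_cast at h
  have h1 : ((n : ℝ) + k - 7) ^ 2 ≤ (Real.sqrt 2 * (n - 11 / 2)) ^ 2 :=
    pow_le_pow_left₀ (by linarith) (by linarith) 2
  rw [mul_pow, Real.sq_sqrt (by norm_num)] at h1
  have h2 : 2 * ((n : ℝ) + k - 7) ^ 2 ≤ (2 * n - 11) ^ 2 := by linarith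
  have h3 : 2 * (n + k - 7 : ℤ) ^ 2 ≤ (2 * n - 11) ^ 2 := by exact_mod_cast h2
  -- Equality is impossible by parity: an odd square is not twice a square.
  refine lt_of_le_of_ne h3 fun h => ?_
  have : (2 * n - 11 : ℤ) ^ 2 = 2 * (2 * n ^ 2 - 22 * n + 60) + 1 := by ring
  omega

theorem lt_of_bagThreshold_le {n k : ℕ} (hn : 11 ≤ n) (h : bagThreshold n ≤ k) :
    (2 * n - 11 : ℤ) ^ 2 < 2 * (n + k - 8) ^ 2 := by
  have hn' : (11 : ℝ) ≤ n := by exact_mod_cast hn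
  rw [bagThreshold_eq] at h
  have h1 : (Real.sqrt 2 * (n - 11 / 2)) ^ 2 ≤ ((n : ℝ) + k - 8) ^ 2 :=
    pow_le_pow_left₀ (mul_nonneg (Real.sqrt_nonneg 2) (by linarith)) (by linarith) 2
  rw [mul_pow, Real.sq_sqrt (by norm_num)] at h1
  have h2 : (2 * n - 11 : ℝ) ^ 2 ≤ 2 * ((n : ℝ) + k - 8) ^ 2 := by linarith
  have h3 : (2 * n - 11 : ℤ) ^ 2 ≤ 2 * (n + k - 8) ^ 2 := by exact_mod_cast h2
  refine lt_of_le_of_ne h3 fun h => ?_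
  have : (2 * n - 11 : ℤ) ^ 2 = 2 * (2 * n ^ 2 - 22 * n + 60) + 1 := by ring
  omega

theorem three_le_bagThreshold {n : ℕ} (hn : 11 ≤ n) : 3 ≤ bagThreshold n := by
  have hn' : (11 : ℝ) ≤ n := by exact_mod_cast hn
  have h : (1.4 : ℝ) ≤ Real.sqrt 2 := Real.le_sqrt_of_sq_le (by norm_num)
  rw [bagThreshold_eq]
  nlinarith

theorem bagThreshold_add_one_le {n : ℕ} (hn : 11 ≤ n) : bagThreshold n + 1 ≤ n := by
  have hn' : (11 : ℝ) ≤ n := by exact_mod_cast hn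
  have h : Real.sqrt 2 ≤ (1.5 : ℝ) := Real.sqrt_le_iff.2 (by norm_num)
  rw [bagThreshold_eq]
  nlinarith

theorem three_le_floor_bagThreshold {n : ℕ} (hn : 11 ≤ n) : 3 ≤ ⌊bagThreshold n⌋₊ :=
  Nat.le_floor (by exact_mod_cast three_le_bagThreshold hn)

theorem ceil_bagThreshold_lt {n : ℕ} (hn : 11 ≤ n) : ⌈bagThreshold n⌉₊ < n := by
  have h := Nat.ceil_lt_add_one ((zero_le_three (α := ℝ)).trans (three_le_bagThreshold hn))
  exact_mod_cast h.trans_le (bagThreshold_add_one_le hn)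

theorem transmissionPrice_lt_floor {n k : ℕ} (hn : 11 ≤ n) (hk : 3 ≤ k)
    (h : k < ⌊bagThreshold n⌋₊) : (backwardBag n k).transmissionPrice <
      (backwardBag n ⌊bagThreshold n⌋₊).transmissionPrice := by
  have hr := (zero_le_three (α := ℝ)).trans (three_le_bagThreshold hn)
  have hlt := (Nat.floor_le_ceil (bagThreshold n)).trans_lt (ceil_bagThreshold_lt hn)
  have key : ∀ q, k + 1 ≤ q → q ≤ ⌊bagThreshold n⌋₊ →
      (backwardBag n k).transmissionPrice < (backwardBag n q).transmissionPrice := by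
    intro q hq
    have step : ∀ p, k ≤ p → p + 1 ≤ ⌊bagThreshold n⌋₊ →
        (backwardBag n p).transmissionPrice < (backwardBag n (p + 1)).transmissionPrice :=
      fun p hp hp' => transmissionPrice_backwardBag_lt_succ hn (by omega) (by omega)
        (lt_of_le_bagThreshold hn (by omega) ((Nat.le_floor_iff hr).1 hp'))
    induction q, hq using Nat.le_induction with
    | base => exact step k le_rfl
    | succ q hq ih => exact fun h => (ih (by omega)).trans (step q (by omega) h)
  exact key _ h le_rfl

theorem transmissionPrice_lt_ceil {n k : ℕ} (hn : 11 ≤ n) (hk : k < n)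
    (h : ⌈bagThreshold n⌉₊ < k) : (backwardBag n k).transmissionPrice <
      (backwardBag n ⌈bagThreshold n⌉₊).transmissionPrice := by
  have h3 := (three_le_floor_bagThreshold hn).trans (Nat.floor_le_ceil (bagThreshold n))
  have step : ∀ p, ⌈bagThreshold n⌉₊ ≤ p → p + 1 < n →
      (backwardBag n (p + 1)).transmissionPrice < (backwardBag n p).transmissionPrice :=
    fun p hp hp' => transmissionPrice_backwardBag_succ_lt (by omega) hp'
      (lt_of_bagThreshold_le hn (Nat.ceil_le.1 hp))
  induction k, Nat.succ_le_of_lt h using Nat.le_induction with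
  | base => exact step _ le_rfl hk
  | succ q hq ih => exact (step q (by omega) hk).trans (ih (by omega) (by omega))

theorem kStar_nonempty (n : ℕ) : (kStar n).Nonempty := by
  rcases max_choice (backwardBag n ⌊bagThreshold n⌋₊).transmissionPrice
    (backwardBag n ⌈bagThreshold n⌉₊).transmissionPrice with h | h
  · exact ⟨_, .inl rfl, h.symm⟩
  · exact ⟨_, .inr rfl, h.symm⟩

end Digraph

theorem mainTheorem1 (n : ℕ) (hn : 11 ≤ n) :
    -- the backward bag has the largest price among the bags with the same `n` and `k`
    (∀ k : ℕ, 3 ≤ k → k < n →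
      ∀ (V : Type*) [Fintype V] (T : Digraph V), Fintype.card V = k → T.IsTournament →
      ∀ a : V × V, T.Adj a.1 a.2 → (Digraph.bag n k T a).StronglyConnected →
        (Digraph.bag n k T a).transmissionPrice ≤ (Digraph.backwardBag n k).transmissionPrice) ∧
    -- all backward bags are strongly connected, so that their prices are meaningful
    (∀ k : ℕ, 3 ≤ k → k < n → (Digraph.backwardBag n k).StronglyConnected) ∧
    -- `⌊r⌋` and `⌈r⌉` are admissible values of `k`, and `k*` exists
    (3 ≤ ⌊Digraph.bagThreshold n⌋₊ ∧ ⌈Digraph.bagThreshold n⌉₊ < n ∧ (Digraph.kStar n).Nonempty) ∧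
    -- the price of the backward bag is largest exactly at `k*`
    (∀ ks ∈ Digraph.kStar n, ∀ k : ℕ, 3 ≤ k → k < n →
      (Digraph.backwardBag n k).transmissionPrice ≤ (Digraph.backwardBag n ks).transmissionPrice ∧
      ((Digraph.backwardBag n k).transmissionPrice = (Digraph.backwardBag n ks).transmissionPrice ↔
        k ∈ Digraph.kStar n)) := by
  refine ⟨?_, ?_, ⟨Digraph.three_le_floor_bagThreshold hn, Digraph.ceil_bagThreshold_lt hn,
    Digraph.kStar_nonempty n⟩, ?_⟩
  · rintro k hk - V _ T hc hT ⟨u, v⟩ huv hb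
    obtain ⟨k, rfl⟩ := Nat.exists_eq_add_of_le' hk
    exact hT.transmissionPrice_bag_le hc huv hb
  · intro k hk _
    obtain ⟨k, rfl⟩ := Nat.exists_eq_add_of_le' hk
    exact Digraph.stronglyConnected_backwardBag n k
  · rintro ks ⟨-, hks⟩ k hk hkn
    rw [hks]
    have hle := Nat.ceil_le_floor_add_one (Digraph.bagThreshold n)
    by_cases hkm : k = ⌊Digraph.bagThreshold n⌋₊ ∨ k = ⌈Digraph.bagThreshold n⌉₊
    · refine ⟨?_, fun h => ⟨hkm, h⟩, fun h => h.2⟩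
      rcases hkm with h | h
      · rw [← h]; exact le_max_left _ _
      · rw [← h]; exact le_max_right _ _
    · have hlt : (Digraph.backwardBag n k).transmissionPrice <
          max (Digraph.backwardBag n ⌊Digraph.bagThreshold n⌋₊).transmissionPrice
            (Digraph.backwardBag n ⌈Digraph.bagThreshold n⌉₊).transmissionPrice := by
        rcases lt_or_ge k ⌊Digraph.bagThreshold n⌋₊ with h | h
        · exact lt_max_of_lt_left (Digraph.transmissionPrice_lt_floor hn hk h)
        -- As ⌈r⌉ ≤ ⌊r⌋ + 1, a k at least ⌊r⌋ and different from both lies beyond ⌈r⌉.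
        · exact lt_max_of_lt_right (Digraph.transmissionPrice_lt_ceil hn hkn (by omega))
      exact ⟨hlt.le, fun h => absurd h hlt.ne, fun h => absurd h.1 hkm⟩
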